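/- All spaces are over $\mathbb{C}$. An operator space is a normed space $X$ with norms on all the matrix spaces $M_n(X)$ (the given norm for $n=1$) such that $\|x\oplus y\|=\max\{\|x\|,\|y\|\}$ and $\|\alpha x\beta\|\le\|\alpha\|\,\|x\|\,\|\beta\|$ for scalar matrices $\alpha,\beta$; rectangular matrices are normed by completing them with zeros to square ones. The dual $X^*$ is an operator space through $M_n(X^*)=CB(X,M_n)$. A dual operator space is an operator space $X$ with a completely isometric identification $X=(X_*)^*$ for a (norm complete) operator space $X_*$. A projection is a linear idempotent map. A projection $P$ on $X$ is a complete left $M$-projection if for all $n$ and $x\in M_n(X)$ $$\|x\|=\left\|\begin{bmatrix}P_n(x)\\ x-P_n(x)\end{bmatrix}\right\|_{M_{2n,n}(X)},$$ where $P_n$ acts entrywise; it is a complete right $L$-projection if $x\mapsto[P(x)\ \ x-P(x)]$ is a complete isometry of $X$ into $R_2[X]=R_2\hat\otimes X$, where $R_2=M_{1,2}(\mathbb{C})$ and $\hat\otimes$ is the operator space projective tensor product. A complete right $M$-summand of $X$ is the range of a complete left $M$-projection on $X$; a complete left $L$-summand is the range of a complete right $L$-projection; a complete right $M$-ideal of $X$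 is a closed subspace $J$ such that $J^{\perp\perp}$ is a complete right $M$-summand of $X^{**}$. A Banach space is a dual Banach space if it is isometrically isomorphic to the dual of a Banach space. **Theorem.** Let $X$ be an operator space. (a) Let $P$ be a complete left $M$-projection on $X$. If $Q$ is a contractive projection on $X$ with $\operatorname{Ran}Q=\operatorname{Ran}P$, then $P=Q$. (b) Let $P$ be a complete right $L$-projection on $X$. If $Q$ is a contractive projection on $X$ with $\ker Q=\ker P$, then $Q=P$. (c) If there is a contractive projection from $X$ onto a complete right $M$-ideal $J$ of $X$, then $J$ is a complete right $M$-summand of $X$, and the contractive projection of $X$ onto $J$ is unique. (d) If $J$ is a complete right $M$-ideal of $X$ and $J$ is a dual Banach space, then $J$ is a complete right $M$-summand of $X$. (e) If $X$ is a dual operator space and $J$ is a weak*-closed complete right $M$-ideal of $X$, then $J$ is a complete right $M$-summand of $X$, and $J$ is the annihilator of a complete left $L$-summand of $X_*$. -/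

import Mathlib

open scoped Matrix.Norms.L2Operator

noncomputable section

/-- The matrix `α x β` for scalar matrices `α`, `β` and a matrix `x` over a vector space. -/
def matSandwich {X : Type*} [AddCommGroup X] [Module ℂ X] {a b c d : Type*} [Fintype b]
    [Fintype c] (α : Matrix a b ℂ) (x : Matrix b c X) (β : Matrix c d ℂ) : Matrix a d X :=
  Matrix.of fun i j => ∑ k, ∑ l, (α i k * β l j) • x k l

/-- The square matrix with blocks `x y` in the first row and `z w` in the second row. -/
def matBlocks {X : Type*} {m n : ℕ} (x : Matrix (Fin m) (Fin m) X) (y : Matrix (Fin m) (Fin n) X)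
    (z : Matrix (Fin n) (Fin m) X) (w : Matrix (Fin n) (Fin n) X) :
    Matrix (Fin (m + n)) (Fin (m + n)) X :=
  Matrix.reindex finSumFinEquiv finSumFinEquiv (Matrix.fromBlocks x y z w)

/-- An (abstract) operator space: a complex normed space `X` with a norm `matNorm n` on every
`M_n(X)`, equal to the given norm for `n = 1`, such that `‖x ⊕ y‖ = max ‖x‖ ‖y‖` and
`‖α x β‖ ≤ ‖α‖ ‖x‖ ‖β‖`. Scalar matrices carry the operator norm between Euclidean spaces.
The seminorms `matNorm n` are norms (see `OperatorSpace.eq_zero_of_matNorm_eq_zero`). -/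
class OperatorSpace (X : Type*) [NormedAddCommGroup X] [NormedSpace ℂ X] where
  matNorm : ∀ n : ℕ, Seminorm ℂ (Matrix (Fin n) (Fin n) X)
  matNorm_one : ∀ x : X, matNorm 1 (Matrix.of fun _ _ => x) = ‖x‖
  matNorm_directSum : ∀ (m n : ℕ) (x : Matrix (Fin m) (Fin m) X) (y : Matrix (Fin n) (Fin n) X),
    matNorm (m + n) (matBlocks x 0 0 y) = max (matNorm m x) (matNorm n y)
  matNorm_sandwich_le : ∀ (m n : ℕ) (α : Matrix (Fin n) (Fin m) ℂ)
    (x : Matrix (Fin m) (Fin m) X) (β : Matrix (Fin m) (Fin n) ℂ),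
    matNorm n (matSandwich α x β) ≤ ‖α‖ * matNorm m x * ‖β‖

namespace OperatorSpace

section ScalarMatrices

variable {a b c d : Type*} [Fintype a] [Fintype b] [Fintype c] [Fintype d]
  [DecidableEq a] [DecidableEq b] [DecidableEq c] [DecidableEq d]


lemma l2_le_of_sq (A : Matrix a b ℂ) (C : ℝ) (hC : 0 ≤ C)
    (h : ∀ v : b → ℂ, ∑ i, ‖A.mulVec v i‖ ^ 2 ≤ C ^ 2 * ∑ j, ‖v j‖ ^ 2) : ‖A‖ ≤ C := by
  rw [Matrix.l2_opNorm_def]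
  refine ContinuousLinearMap.opNorm_le_bound _ hC fun x => ?_
  refine (sq_le_sq₀ (norm_nonneg _) (by positivity)).mp ?_
  rw [mul_pow, EuclideanSpace.norm_sq_eq, EuclideanSpace.norm_sq_eq]
  exact h x.ofLp

lemma sq_le_l2 (A : Matrix a b ℂ) (v : b → ℂ) :
    ∑ i, ‖A.mulVec v i‖ ^ 2 ≤ ‖A‖ ^ 2 * ∑ j, ‖v j‖ ^ 2 := by
  have h := Matrix.l2_opNorm_mulVec A (WithLp.toLp 2 v)
  have h2 := (sq_le_sq₀ (norm_nonneg _) (by positivity)).mpr h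
  rw [mul_pow, EuclideanSpace.norm_sq_eq, EuclideanSpace.norm_sq_eq] at h2
  exact h2

lemma l2_kron_one_le (A : Matrix a b ℂ) :
    ‖(Matrix.of fun (p : a × c) (q : b × c) => if p.2 = q.2 then A p.1 q.1 else 0 :
      Matrix (a × c) (b × c) ℂ)‖ ≤ ‖A‖ := by
  refine l2_le_of_sq _ _ (norm_nonneg _) fun v => ?_
  rw [Fintype.sum_prod_type_right, Fintype.sum_prod_type_right, Finset.mul_sum]
  refine Finset.sum_le_sum fun k _ => ?_
  refine le_trans (le_of_eq ?_) (sq_le_l2 A fun j => v (j, k))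
  refine Finset.sum_congr rfl fun i _ => ?_
  congr 2
  simp [Matrix.mulVec, dotProduct, Fintype.sum_prod_type]

lemma l2_submatrix_le (A : Matrix a b ℂ) (e : c → a) (e' : d → b) (he : Function.Injective e)
    (he' : Function.Injective e') : ‖A.submatrix e e'‖ ≤ ‖A‖ := by
  refine l2_le_of_sq _ _ (norm_nonneg _) fun v => ?_
  set v' : b → ℂ := Function.extend e' v 0
  have hv : ∀ j, v' (e' j) = v j := fun j => he'.extend_apply v (0 : b → ℂ) j
  have hv0 : ∀ k, k ∉ Set.range e' → v' k = 0 := fun k hk =>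
    Function.extend_apply' v (0 : b → ℂ) k hk
  have h2 : ∑ j, ‖v j‖ ^ 2 = ∑ j, ‖v' j‖ ^ 2 :=
    Finset.sum_of_injOn e' he'.injOn (by simp) (fun k _ hk => by rw [hv0 k (by simpa using hk)]; simp)
      fun j _ => by rw [hv]
  have h1 : ∀ i, (A.submatrix e e').mulVec v i = A.mulVec v' (e i) :=
    fun i => Finset.sum_of_injOn e' he'.injOn (by simp)
      (fun k _ hk => by rw [hv0 k (by simpa using hk)]; simp) fun j _ => by rw [hv]; rfl
  rw [h2]
  refine le_trans ?_ (sq_le_l2 A _)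
  simp only [h1]
  refine le_of_eq_of_le
    (Finset.sum_map Finset.univ ⟨e, he⟩ fun i => ‖A.mulVec v' i‖ ^ 2).symm ?_
  exact Finset.sum_le_sum_of_subset_of_nonneg (Finset.subset_univ _) fun _ _ _ => by positivity

lemma l2_block_le (A : Matrix c d ℂ) (i : a) (j : b) :
    ‖(Matrix.of fun (p : a × c) (q : b × d) => if p.1 = i ∧ q.1 = j then A p.2 q.2 else 0 :
      Matrix (a × c) (b × d) ℂ)‖ ≤ ‖A‖ := by
  refine l2_le_of_sq _ _ (norm_nonneg _) fun v => ?_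
  rw [Fintype.sum_prod_type, Finset.sum_eq_single i]
  · refine le_trans (le_of_eq ?_) ((sq_le_l2 A fun l => v (j, l)).trans ?_)
    · refine Finset.sum_congr rfl fun k _ => ?_
      congr 2
      simp only [Matrix.mulVec, dotProduct, Matrix.of_apply, true_and, Fintype.sum_prod_type]
      rw [Finset.sum_eq_single j] <;> simp +contextual
    · rw [Fintype.sum_prod_type]
      gcongr
      exact Finset.single_le_sum (f := fun j => ∑ l, ‖v (j, l)‖ ^ 2)
        (fun _ _ => by positivity) (Finset.mem_univ j)
  · intro i' _ hi
    refine Finset.sum_eq_zero fun k _ => ?_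
    simp [Matrix.mulVec, dotProduct, hi]
  · simp

lemma l2_column (v : a → ℂ) :
    ‖(Matrix.of fun i (_ : Fin 1) => v i : Matrix a (Fin 1) ℂ)‖ ^ 2 ≤ ∑ i, ‖v i‖ ^ 2 := by
  have h0 : 0 ≤ ∑ i, ‖v i‖ ^ 2 := by positivity
  have : ‖(Matrix.of fun i (_ : Fin 1) => v i : Matrix a (Fin 1) ℂ)‖ ≤
      Real.sqrt (∑ i, ‖v i‖ ^ 2) := by
    refine l2_le_of_sq _ _ (Real.sqrt_nonneg _) fun w => ?_
    rw [Real.sq_sqrt h0]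
    simp [Matrix.mulVec, dotProduct, mul_pow, Finset.sum_mul]
  calc _ ≤ Real.sqrt (∑ i, ‖v i‖ ^ 2) ^ 2 := by gcongr
    _ = _ := Real.sq_sqrt h0

lemma l2_row (v : a → ℂ) :
    ‖(Matrix.of fun (_ : Fin 1) i => star (v i) : Matrix (Fin 1) a ℂ)‖ ^ 2 ≤
      ∑ i, ‖v i‖ ^ 2 := by
  have h : (Matrix.of fun (_ : Fin 1) i => star (v i) : Matrix (Fin 1) a ℂ) =
      (Matrix.of fun i (_ : Fin 1) => v i : Matrix a (Fin 1) ℂ).conjTranspose := by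
    ext i j; simp [Matrix.conjTranspose_apply]
  rw [h, Matrix.l2_opNorm_conjTranspose]
  exact l2_column v

end ScalarMatrices

variable {X : Type*} [NormedAddCommGroup X] [NormedSpace ℂ X] [OperatorSpace X]

lemma norm_entry_le {n : ℕ} (x : Matrix (Fin n) (Fin n) X) (i j : Fin n) :
    ‖x i j‖ ≤ matNorm n x := by
  have h := matNorm_sandwich_le n 1
    (Matrix.of fun (_ : Fin 1) k => star (if k = i then (1 : ℂ) else 0))
    x (Matrix.of fun k (_ : Fin 1) => if k = j then (1 : ℂ) else 0)
  have e : matSandwich (Matrix.of fun (_ : Fin 1) k => star (if k = i then (1 : ℂ) else 0))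
      x (Matrix.of fun k (_ : Fin 1) => if k = j then (1 : ℂ) else 0) =
      (Matrix.of fun _ _ => x i j : Matrix (Fin 1) (Fin 1) X) := by
    ext s t
    simp only [matSandwich, Matrix.of_apply]
    rw [Finset.sum_eq_single i, Finset.sum_eq_single j] <;> simp +contextual
  rw [e, matNorm_one] at h
  have s1 : ∀ i : Fin n, ∑ k, ‖(if k = i then (1 : ℂ) else 0)‖ ^ 2 = 1 := by
    intro i
    rw [Finset.sum_eq_single i] <;> simp +contextual
  have h1 := l2_row fun k => if k = i then (1 : ℂ) else 0
  have h2 := l2_column fun k => if k = j then (1 : ℂ) else 0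
  rw [s1] at h1 h2
  have h1' := (sq_le_one_iff₀ (norm_nonneg _)).mp h1
  have h2' := (sq_le_one_iff₀ (norm_nonneg _)).mp h2
  have h0 := apply_nonneg (matNorm (X := X) n) x
  refine h.trans ?_
  calc _ ≤ 1 * matNorm n x * 1 := by gcongr
    _ = _ := by ring

lemma eq_zero_of_matNorm_eq_zero {n : ℕ} (x : Matrix (Fin n) (Fin n) X) (h : matNorm n x = 0) :
    x = 0 := by
  ext i j
  have := norm_entry_le x i j
  rw [h] at this
  simpa using this

/-- The scalar matrix `[f_ij(x_kl)]` in `M_n(M_m) = M_nm` for `f ∈ M_n(X*)`, `x ∈ M_m(X)`. -/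
def matPairing {m n : ℕ} (f : Matrix (Fin n) (Fin n) (StrongDual ℂ X))
    (x : Matrix (Fin m) (Fin m) X) : Matrix (Fin n × Fin m) (Fin n × Fin m) ℂ :=
  Matrix.of fun p q => f p.1 q.1 (x p.2 q.2)

/-- The values whose supremum is the completely bounded norm of `x ↦ [f_ij(x)]`, `X → M_n`. -/
def dualNormSet {n : ℕ} (f : Matrix (Fin n) (Fin n) (StrongDual ℂ X)) : Set ℝ :=
  {r | ∃ (m : ℕ) (x : Matrix (Fin m) (Fin m) X), matNorm m x ≤ 1 ∧ r = ‖matPairing f x‖}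

lemma norm_functional_le (f : StrongDual ℂ X) {m : ℕ} (x : Matrix (Fin m) (Fin m) X) :
    ‖(Matrix.of fun k l => f (x k l) : Matrix (Fin m) (Fin m) ℂ)‖ ≤ ‖f‖ * matNorm m x := by
  have hx0 := apply_nonneg (matNorm (X := X) m) x
  refine l2_le_of_sq _ _ (by positivity) fun v => ?_
  set w := (Matrix.of fun k l => f (x k l) : Matrix (Fin m) (Fin m) ℂ).mulVec v with hw
  set S := ∑ i, ‖w i‖ ^ 2 with hS
  set T := ∑ j, ‖v j‖ ^ 2 with hT
  have hS0 : 0 ≤ S := by positivity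
  have hT0 : 0 ≤ T := by positivity
  have h := matNorm_sandwich_le m 1 (Matrix.of fun (_ : Fin 1) k => star (w k)) x
    (Matrix.of fun l (_ : Fin 1) => v l)
  set z : X := ∑ k, ∑ l, (star (w k) * v l) • x k l with hz
  have e : matSandwich (Matrix.of fun (_ : Fin 1) k => star (w k)) x
      (Matrix.of fun l (_ : Fin 1) => v l) = (Matrix.of fun _ _ => z) := by
    ext s t; simp [matSandwich, hz]
  rw [e, matNorm_one] at h
  have hfz : f z = (S : ℂ) := by
    rw [hz, hS, map_sum, Complex.ofReal_sum]
    refine Finset.sum_congr rfl fun k _ => ?_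
    rw [map_sum]
    have : ∀ l, f ((star (w k) * v l) • x k l) = star (w k) * (f (x k l) * v l) := fun l => by
      rw [map_smul, smul_eq_mul]; ring
    simp only [this]
    rw [← Finset.mul_sum]
    change star (w k) * w k = _
    rw [Complex.ofReal_pow, ← Complex.conj_mul']
    rfl
  have hSz : S ≤ ‖f‖ * ‖z‖ := by
    have := f.le_opNorm z
    rw [hfz, Complex.norm_real, Real.norm_of_nonneg hS0] at this
    exact this
  have hr := l2_row w
  have hc := l2_column v
  set r := ‖(Matrix.of fun (_ : Fin 1) k => star (w k) : Matrix (Fin 1) (Fin m) ℂ)‖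
  set c := ‖(Matrix.of fun l (_ : Fin 1) => v l : Matrix (Fin m) (Fin 1) ℂ)‖
  have hr0 : 0 ≤ r := norm_nonneg _
  have hc0 : 0 ≤ c := norm_nonneg _
  have h3 : S ≤ ‖f‖ * (r * matNorm m x * c) := hSz.trans (by gcongr)
  rcases hS0.eq_or_lt with h0 | h0
  · rw [← h0]; positivity
  · have h4 : S ^ 2 ≤ S * ((‖f‖ * matNorm m x) ^ 2 * T) := by
      calc S ^ 2 ≤ (‖f‖ * (r * matNorm m x * c)) ^ 2 := by gcongr
        _ = r ^ 2 * ((‖f‖ * matNorm m x) ^ 2 * c ^ 2) := by ring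
        _ ≤ S * ((‖f‖ * matNorm m x) ^ 2 * T) := by gcongr
    rw [sq] at h4
    exact le_of_mul_le_mul_left h4 h0

lemma norm_matPairing_le_sum {m n : ℕ} (f : Matrix (Fin n) (Fin n) (StrongDual ℂ X))
    (x : Matrix (Fin m) (Fin m) X) :
    ‖matPairing f x‖ ≤ (∑ i, ∑ j, ‖f i j‖) * matNorm m x := by
  have e : matPairing f x = ∑ i, ∑ j, (Matrix.of fun (p q : Fin n × Fin m) =>
      if p.1 = i ∧ q.1 = j then
        (Matrix.of fun k l => f i j (x k l) : Matrix (Fin m) (Fin m) ℂ) p.2 q.2 else 0) := by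
    ext p q
    simp only [Matrix.sum_apply, Matrix.of_apply, matPairing]
    rw [Finset.sum_eq_single p.1, Finset.sum_eq_single q.1] <;> simp +contextual [eq_comm]
  rw [e, Finset.sum_mul]
  refine (norm_sum_le _ _).trans (Finset.sum_le_sum fun i _ => ?_)
  rw [Finset.sum_mul]
  refine (norm_sum_le _ _).trans (Finset.sum_le_sum fun j _ => ?_)
  exact (l2_block_le _ i j).trans (norm_functional_le _ _)

lemma bddAbove_dualNormSet {n : ℕ} (f : Matrix (Fin n) (Fin n) (StrongDual ℂ X)) :
    BddAbove (dualNormSet f) := by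
  refine ⟨∑ i, ∑ j, ‖f i j‖, ?_⟩
  rintro r ⟨m, x, hx, rfl⟩
  refine (norm_matPairing_le_sum f x).trans ?_
  exact mul_le_of_le_one_right (by positivity) hx

lemma norm_matPairing_le_sSup {m n : ℕ} (f : Matrix (Fin n) (Fin n) (StrongDual ℂ X))
    (x : Matrix (Fin m) (Fin m) X) (hx : matNorm m x ≤ 1) :
    ‖matPairing f x‖ ≤ sSup (dualNormSet f) :=
  le_csSup (bddAbove_dualNormSet f) ⟨m, x, hx, rfl⟩

lemma sSup_dualNormSet_nonneg {n : ℕ} (f : Matrix (Fin n) (Fin n) (StrongDual ℂ X)) :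
    0 ≤ sSup (dualNormSet f) :=
  Real.sSup_nonneg (by rintro r ⟨m, x, hx, rfl⟩; exact norm_nonneg _)

lemma sSup_dualNormSet_le {n : ℕ} (f : Matrix (Fin n) (Fin n) (StrongDual ℂ X)) (C : ℝ)
    (hC : 0 ≤ C)
    (h : ∀ (m : ℕ) (x : Matrix (Fin m) (Fin m) X), matNorm m x ≤ 1 → ‖matPairing f x‖ ≤ C) :
    sSup (dualNormSet f) ≤ C :=
  Real.sSup_le (by rintro r ⟨m, x, hx, rfl⟩; exact h m x hx) hC

variable (X) in
/-- The norm of `M_n(X*) = CB(X, M_n)`: `‖[f_ij]‖` is the supremum of `‖[f_ij(x_kl)]‖` over all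
`m` and all `x` in the closed unit ball of `M_m(X)`. -/
def dualMatNorm (n : ℕ) : Seminorm ℂ (Matrix (Fin n) (Fin n) (StrongDual ℂ X)) :=
  Seminorm.ofSMulLE (𝕜 := ℂ) (fun f : Matrix (Fin n) (Fin n) (StrongDual ℂ X) => sSup (dualNormSet f))
    (by
      refine le_antisymm (sSup_dualNormSet_le _ _ le_rfl fun m x _ => ?_)
        (sSup_dualNormSet_nonneg _)
      have : matPairing (0 : Matrix (Fin n) (Fin n) (StrongDual ℂ X)) x = 0 := by
        ext p q; simp [matPairing]
      rw [this, norm_zero])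
    (fun f g => by
      refine sSup_dualNormSet_le _ _
        (add_nonneg (sSup_dualNormSet_nonneg _) (sSup_dualNormSet_nonneg _)) fun m x hx => ?_
      have : matPairing (f + g) x = matPairing f x + matPairing g x := by
        ext p q; simp [matPairing]
      rw [this]
      exact (norm_add_le _ _).trans
        (add_le_add (norm_matPairing_le_sSup f x hx) (norm_matPairing_le_sSup g x hx)))
    (fun c f => by
      refine sSup_dualNormSet_le _ _
        (mul_nonneg (norm_nonneg c) (sSup_dualNormSet_nonneg _)) fun m x hx => ?_
      have : matPairing (c • f) x = c • matPairing f x := by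
        ext p q; simp [matPairing]
      rw [this, norm_smul]
      exact mul_le_mul_of_nonneg_left (norm_matPairing_le_sSup f x hx) (norm_nonneg c))

/-- The dual operator space structure on `X*`. -/
instance instDual : OperatorSpace (StrongDual ℂ X) where
  matNorm n := dualMatNorm X n
  matNorm_one f := by
    change sSup (dualNormSet (Matrix.of fun (_ _ : Fin 1) => f)) = ‖f‖
    refine le_antisymm (sSup_dualNormSet_le _ _ (norm_nonneg _) fun m x hx => ?_) ?_
    · refine (norm_matPairing_le_sum _ x).trans ?_
      simpa using mul_le_of_le_one_right (norm_nonneg f) hx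
    · refine f.opNorm_le_of_unit_norm (sSup_dualNormSet_nonneg _) fun x hx => ?_
      have h := norm_matPairing_le_sSup (Matrix.of fun (_ _ : Fin 1) => f)
        (Matrix.of fun (_ _ : Fin 1) => x) (by rw [matNorm_one, hx])
      refine le_trans ?_ h
      have h2 := sq_le_l2 (matPairing (Matrix.of fun (_ _ : Fin 1) => f)
        (Matrix.of fun (_ _ : Fin 1) => x)) fun _ => 1
      simp only [Matrix.mulVec, dotProduct, matPairing, Matrix.of_apply, Finset.sum_const,
        Finset.card_univ, Fintype.card_prod, Fintype.card_fin, one_smul, mul_one, norm_one,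
        one_pow] at h2
      exact (sq_le_sq₀ (norm_nonneg _) (norm_nonneg _)).mp h2
  matNorm_directSum m n f g := by
    change sSup (dualNormSet (matBlocks f 0 0 g)) = max (sSup (dualNormSet f)) (sSup (dualNormSet g))
    refine le_antisymm ?_ (max_le ?_ ?_)
    · refine sSup_dualNormSet_le _ _ (le_max_of_le_left (sSup_dualNormSet_nonneg _))
        fun k x hx => ?_
      have hf := norm_matPairing_le_sSup f x hx
      have hg := norm_matPairing_le_sSup g x hx
      set C := max (sSup (dualNormSet f)) (sSup (dualNormSet g)) with hC
      have hf' : ‖matPairing f x‖ ≤ C := hf.trans (le_max_left _ _)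
      have hg' : ‖matPairing g x‖ ≤ C := hg.trans (le_max_right _ _)
      refine l2_le_of_sq _ _ ((norm_nonneg _).trans hf') fun v => ?_
      have h1 := sq_le_l2 (matPairing f x) fun p => v (Fin.castAdd n p.1, p.2)
      have h2 := sq_le_l2 (matPairing g x) fun p => v (Fin.natAdd m p.1, p.2)
      have e1 : ∀ p : Fin m × Fin k, (matPairing (matBlocks f 0 0 g) x).mulVec v
          (Fin.castAdd n p.1, p.2) =
          (matPairing f x).mulVec (fun p => v (Fin.castAdd n p.1, p.2)) p := by
        intro p
        simp [Matrix.mulVec, dotProduct, Fintype.sum_prod_type, Fin.sum_univ_add, matPairing,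
          matBlocks]
      have e2 : ∀ p : Fin n × Fin k, (matPairing (matBlocks f 0 0 g) x).mulVec v
          (Fin.natAdd m p.1, p.2) =
          (matPairing g x).mulVec (fun p => v (Fin.natAdd m p.1, p.2)) p := by
        intro p
        simp [Matrix.mulVec, dotProduct, Fintype.sum_prod_type, Fin.sum_univ_add, matPairing,
          matBlocks]
      simp only [← e1] at h1
      simp only [← e2] at h2
      rw [Fintype.sum_prod_type, Fintype.sum_prod_type] at h1 h2 ⊢
      rw [Fin.sum_univ_add, Fin.sum_univ_add, mul_add]
      refine add_le_add (h1.trans ?_) (h2.trans ?_) <;> gcongr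
    · refine sSup_dualNormSet_le _ _ (sSup_dualNormSet_nonneg _) fun k x hx => ?_
      refine le_trans ?_ (norm_matPairing_le_sSup (matBlocks f 0 0 g) x hx)
      have : matPairing f x = (matPairing (matBlocks f 0 0 g) x).submatrix
          (fun p => (Fin.castAdd n p.1, p.2)) (fun p => (Fin.castAdd n p.1, p.2)) := by
        ext p q; simp [matPairing, matBlocks]
      rw [this]
      refine l2_submatrix_le _ _ _ ?_ ?_ <;>
      · rintro ⟨a, b⟩ ⟨c, d⟩ h
        simpa using h
    · refine sSup_dualNormSet_le _ _ (sSup_dualNormSet_nonneg _) fun k x hx => ?_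
      refine le_trans ?_ (norm_matPairing_le_sSup (matBlocks f 0 0 g) x hx)
      have : matPairing g x = (matPairing (matBlocks f 0 0 g) x).submatrix
          (fun p => (Fin.natAdd m p.1, p.2)) (fun p => (Fin.natAdd m p.1, p.2)) := by
        ext p q; simp [matPairing, matBlocks]
      rw [this]
      refine l2_submatrix_le _ _ _ ?_ ?_ <;>
      · rintro ⟨a, b⟩ ⟨c, d⟩ h
        simpa using h
  matNorm_sandwich_le m n α f β := by
    change sSup (dualNormSet (matSandwich α f β)) ≤ ‖α‖ * sSup (dualNormSet f) * ‖β‖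
    have hf0 := sSup_dualNormSet_nonneg f
    refine sSup_dualNormSet_le _ _ (by positivity) fun k x hx => ?_
    have e : matPairing (matSandwich α f β) x =
        (Matrix.of fun (p : Fin n × Fin k) (q : Fin m × Fin k) =>
          if p.2 = q.2 then α p.1 q.1 else 0) * matPairing f x *
        (Matrix.of fun (p : Fin m × Fin k) (q : Fin n × Fin k) =>
          if p.2 = q.2 then β p.1 q.1 else 0) := by
      ext p q
      simp only [matPairing, matSandwich, Matrix.of_apply, Matrix.mul_apply,
        Fintype.sum_prod_type, sum_apply, smul_apply,
        smul_eq_mul, ite_mul, zero_mul, mul_ite, mul_zero, Finset.sum_ite_eq, Finset.sum_ite_eq',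
        Finset.mem_univ, if_true, Finset.sum_mul]
      rw [Finset.sum_comm]
      refine Finset.sum_congr rfl fun i _ => Finset.sum_congr rfl fun j _ => ?_
      ring
    rw [e]
    refine (Matrix.l2_opNorm_mul _ _).trans ?_
    refine mul_le_mul ((Matrix.l2_opNorm_mul _ _).trans ?_) (l2_kron_one_le β) (norm_nonneg _)
      (by positivity)
    exact mul_le_mul (l2_kron_one_le α) (norm_matPairing_le_sSup f x hx) (norm_nonneg _)
      (norm_nonneg _)

/-- The norm of the column `[x; y]` in `C_2(M_n(X)) = M_{2n,n}(X)`. As for every rectangular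
matrix, it is the norm of the square matrix obtained by adding zero columns. -/
def colNorm {n : ℕ} (x y : Matrix (Fin n) (Fin n) X) : ℝ :=
  matNorm (n + n) (matBlocks x 0 y 0)

/-- The norm of `(v 0, v 1)` in `M_p(R_2) = M_{p,2p}(ℂ)`. -/
def rowScalarNorm {p : ℕ} (v : Fin 2 → Matrix (Fin p) (Fin p) ℂ) : ℝ :=
  ‖(Matrix.of fun i (kj : Fin 2 × Fin p) => v kj.1 i kj.2 : Matrix (Fin p) (Fin 2 × Fin p) ℂ)‖

/-- The norm of `[x y]` in `M_n(R_2[X])`, where `R_2[X]` is the operator space projective tensor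
product of `R_2` and `X`, the row `[x y]` being identified with `e_0 ⊗ x + e_1 ⊗ y`. The norm of
`u` is the infimum of `‖α‖ ‖v‖ ‖w‖ ‖β‖` over all representations `u = α (v ⊗ w) β` with
`v ∈ M_p(R_2)`, `w ∈ M_q(X)` and scalar matrices `α ∈ M_{n,pq}`, `β ∈ M_{pq,n}`. -/
def rowProjNorm {n : ℕ} (x y : Matrix (Fin n) (Fin n) X) : ℝ :=
  sInf {r | ∃ (p q : ℕ) (α : Matrix (Fin n) (Fin p × Fin q) ℂ)
    (v : Fin 2 → Matrix (Fin p) (Fin p) ℂ) (w : Matrix (Fin q) (Fin q) X)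
    (β : Matrix (Fin p × Fin q) (Fin n) ℂ),
    x = matSandwich α (Matrix.of fun a b => v 0 a.1 b.1 • w a.2 b.2) β ∧
    y = matSandwich α (Matrix.of fun a b => v 1 a.1 b.1 • w a.2 b.2) β ∧
    r = ‖α‖ * rowScalarNorm v * matNorm q w * ‖β‖}

/-- `P` is a projection and each `P_n` is a left `M`-projection of `M_n(X)`:
`‖x‖ = ‖[P_n x; x - P_n x]‖` in `C_2(M_n(X))`. -/
def IsCompleteLeftMProjection (P : X →ₗ[ℂ] X) : Prop :=
  P ∘ₗ P = P ∧ ∀ (n : ℕ) (x : Matrix (Fin n) (Fin n) X),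
    matNorm n x = colNorm (x.map P) (x - x.map P)

/-- `P` is a projection and `x ↦ [P x, x - P x]`, `X → R_2[X]`, is a complete isometry. -/
def IsCompleteRightLProjection (P : X →ₗ[ℂ] X) : Prop :=
  P ∘ₗ P = P ∧ ∀ (n : ℕ) (x : Matrix (Fin n) (Fin n) X),
    matNorm n x = rowProjNorm (x.map P) (x - x.map P)

/-- The range of a complete left `M`-projection. -/
def IsCompleteRightMSummand (J : Submodule ℂ X) : Prop :=
  ∃ P : X →ₗ[ℂ] X, IsCompleteLeftMProjection P ∧ LinearMap.range P = J

/-- The range of a complete right `L`-projection. -/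
def IsCompleteLeftLSummand (J : Submodule ℂ X) : Prop :=
  ∃ P : X →ₗ[ℂ] X, IsCompleteRightLProjection P ∧ LinearMap.range P = J

/-- A closed subspace `J` whose second annihilator in `X**` is a complete right `M`-summand. -/
def IsCompleteRightMIdeal (J : Submodule ℂ X) : Prop :=
  IsClosed (J : Set X) ∧ IsCompleteRightMSummand (X := StrongDual ℂ (StrongDual ℂ X))
    (StrongDual.polarSubmodule ℂ (StrongDual.polarSubmodule ℂ J))

/-- A linear idempotent of norm at most one. -/
def IsContractiveProjection {E : Type*} [NormedAddCommGroup E] [NormedSpace ℂ E]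
    (Q : E →ₗ[ℂ] E) : Prop :=
  Q ∘ₗ Q = Q ∧ ∀ x, ‖Q x‖ ≤ ‖x‖

/-- All amplifications of `e` preserve the matrix norms. -/
def IsCompleteIsometry {E F : Type*} [NormedAddCommGroup E] [NormedSpace ℂ E] [OperatorSpace E]
    [NormedAddCommGroup F] [NormedSpace ℂ F] [OperatorSpace F] (e : E →ₗ[ℂ] F) : Prop :=
  ∀ (n : ℕ) (x : Matrix (Fin n) (Fin n) E), matNorm n (x.map e) = matNorm n x

end OperatorSpace

end

/-!
A complete left `M`-projection `P` satisfies `‖P u + (v - P v)‖² ≤ ‖P u‖² + ‖v - P v‖²`. If `Q` is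
a contractive projection with the same range and `y = Q (v - P v)`, then `Q` maps `k y + (v - P v)`
to `(k + 1) y`, which is too long for large `k` unless `y = 0`; hence `Q = P`. The adjoint of a
complete right `L`-projection satisfies the same inequality, and passing to adjoints turns equal
kernels into equal ranges.

For a contractive projection `Q` of `X` onto an `M`-ideal `J`, the projection `Q**` has the same
range `J^⊥⊥` as the complete left `M`-projection `P` of `X**`, so `P = Q**` and `Q` is a complete
left `M`-projection. If `J` or `X` is a dual space, the restriction of functionals to the predual
maps `J^⊥⊥` contractively to `J`, and composing it with `P` on `X` yields such a `Q`. In the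
weak*-closed case the growth argument also shows that `P` preserves the kernel of the retraction
`X** → X`, so that `Q` is the adjoint of some `R`. Finally, the norms of `M_n(X)` and of
`M_n(R_2[X])` are determined by pairing with the unit balls of `M_m(X*)` and of columns over
`M_m(X*)`, by the separation theorem of Effros and Winkler for matrix convex sets; this duality
makes `R` a complete right `L`-projection.
-/

noncomputable section

namespace OperatorSpace

open Matrix
open scoped Kronecker

section ScalarMatrices

variable {a b c d : Type*} [Fintype a] [Fintype b] [Fintype c] [Fintype d]

lemma l2_one_le [DecidableEq a] : ‖(1 : Matrix a a ℂ)‖ ≤ 1 :=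
  l2_le_of_sq _ _ zero_le_one fun v => by simp

lemma l2_smul_one_le [DecidableEq a] (r : ℂ) : ‖r • (1 : Matrix a a ℂ)‖ ≤ ‖r‖ := by
  rw [norm_smul]
  exact mul_le_of_le_one_right (norm_nonneg r) l2_one_le

omit [Fintype a] in
lemma l2_one_submatrix_le [Finite a] [DecidableEq a] [DecidableEq c] {f : b → a} {g : c → a}
    (hf : f.Injective) (hg : g.Injective) : ‖(1 : Matrix a a ℂ).submatrix f g‖ ≤ 1 := by
  classical
  cases nonempty_fintype a
  exact (l2_submatrix_le _ f g hf hg).trans l2_one_le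

lemma l2_mul_conjTranspose_self [DecidableEq a] [DecidableEq b] (A : Matrix a b ℂ) :
    ‖A * Aᴴ‖ = ‖A‖ * ‖A‖ := by
  simpa only [conjTranspose_conjTranspose, l2_opNorm_conjTranspose] using
    l2_opNorm_conjTranspose_mul_self Aᴴ

lemma l2_fromRows_sq_le [DecidableEq c] (A : Matrix a c ℂ) (B : Matrix b c ℂ) :
    ‖fromRows A B‖ ^ 2 ≤ ‖A‖ ^ 2 + ‖B‖ ^ 2 := by
  classical
  simp only [pow_two, ← l2_opNorm_conjTranspose_mul_self,
    conjTranspose_fromRows_eq_fromCols_conjTranspose, fromCols_mul_fromRows]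
  exact norm_add_le _ _

lemma l2_fromCols_sq_le [DecidableEq b] [DecidableEq c] (A : Matrix a b ℂ) (B : Matrix a c ℂ) :
    ‖fromCols A B‖ ^ 2 ≤ ‖A‖ ^ 2 + ‖B‖ ^ 2 := by
  classical
  have h := l2_fromRows_sq_le Aᴴ Bᴴ
  rwa [← conjTranspose_fromCols_eq_fromRows_conjTranspose, l2_opNorm_conjTranspose,
    l2_opNorm_conjTranspose, l2_opNorm_conjTranspose] at h

lemma l2_fromBlocks_diagonal_le [DecidableEq b] [DecidableEq d] (A : Matrix a b ℂ)
    (D : Matrix c d ℂ) : ‖fromBlocks A 0 0 D‖ ≤ max ‖A‖ ‖D‖ := by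
  classical
  refine l2_le_of_sq _ _ (le_max_of_le_left (norm_nonneg A)) fun v => ?_
  rw [fromBlocks_mulVec, Fintype.sum_sum_type, Fintype.sum_sum_type, mul_add]
  simp only [Sum.elim_inl, Sum.elim_inr, zero_mulVec, add_zero, zero_add]
  exact add_le_add
    ((sq_le_l2 A _).trans (by gcongr; exacts [le_max_left _ _, le_rfl]))
    ((sq_le_l2 D _).trans (by gcongr; exacts [le_max_right _ _, le_rfl]))

lemma l2_kronecker_one_le [DecidableEq b] [DecidableEq c] (A : Matrix a b ℂ) :
    ‖A ⊗ₖ (1 : Matrix c c ℂ)‖ ≤ ‖A‖ := by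
  classical
  convert l2_kron_one_le (c := c) A using 2
  ext p q
  simp [one_apply]

lemma l2_kronecker_le [DecidableEq b] [DecidableEq d] (A : Matrix a b ℂ) (B : Matrix c d ℂ) :
    ‖A ⊗ₖ B‖ ≤ ‖A‖ * ‖B‖ := by
  classical
  have one_kronecker : (1 : Matrix b b ℂ) ⊗ₖ B =
      (B ⊗ₖ (1 : Matrix b b ℂ)).submatrix Prod.swap Prod.swap := by
    ext p q
    exact mul_comm _ _
  have factor : A ⊗ₖ B = (A ⊗ₖ (1 : Matrix c c ℂ)) * ((1 : Matrix b b ℂ) ⊗ₖ B) := by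
    rw [← mul_kronecker_mul, Matrix.mul_one, Matrix.one_mul]
  rw [factor, one_kronecker]
  refine (l2_opNorm_mul _ _).trans (mul_le_mul (l2_kronecker_one_le A) ?_ (by positivity)
    (norm_nonneg A))
  exact (l2_submatrix_le _ _ _ Prod.swap_injective Prod.swap_injective).trans
    (l2_kronecker_one_le B)

end ScalarMatrices

section Sandwich

variable {V : Type*} [AddCommGroup V] [Module ℂ V]
  {a b c d e f : Type*} [Fintype b] [Fintype c]

lemma matSandwich_matSandwich [Fintype d] [Fintype e] (α : Matrix a b ℂ) (α' : Matrix b c ℂ)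
    (x : Matrix c d V) (β' : Matrix d e ℂ) (β : Matrix e f ℂ) :
    matSandwich α (matSandwich α' x β') β = matSandwich (α * α') x (β' * β) := by
  ext i j
  simp only [matSandwich, of_apply, mul_apply, Finset.smul_sum, smul_smul, Finset.sum_mul_sum,
    Finset.sum_smul, ← Finset.sum_product', Finset.univ_product_univ]
  refine Finset.sum_nbij' (fun p => (p.2.2.1, p.2.2.2, p.1, p.2.1))
    (fun p => (p.2.2.1, p.2.2.2, p.1, p.2.1)) (by simp) (by simp) (by simp) (by simp)
    fun p _ => ?_
  congr 1
  ring

lemma matSandwich_one_submatrix [DecidableEq b] [DecidableEq c] (g : a → b) (h : d → c)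
    (x : Matrix b c V) :
    matSandwich ((1 : Matrix b b ℂ).submatrix g id) x ((1 : Matrix c c ℂ).submatrix id h) =
      x.submatrix g h := by
  ext i j
  simp [matSandwich, one_apply]

lemma matSandwich_one_one [DecidableEq b] [DecidableEq c] (x : Matrix b c V) :
    matSandwich (1 : Matrix b b ℂ) x (1 : Matrix c c ℂ) = x :=
  matSandwich_one_submatrix id id x

lemma matSandwich_smul_smul (s t : ℂ) (α : Matrix a b ℂ) (x : Matrix b c V) (β : Matrix c d ℂ) :
    matSandwich (s • α) x (t • β) = (s * t) • matSandwich α x β := by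
  ext i j
  simp only [matSandwich, of_apply, Matrix.smul_apply, smul_eq_mul, Finset.smul_sum, smul_smul]
  refine Finset.sum_congr rfl fun _ _ => Finset.sum_congr rfl fun _ _ => ?_
  rw [mul_mul_mul_comm]

lemma matSandwich_zero (α : Matrix a b ℂ) (β : Matrix c d ℂ) :
    matSandwich α (0 : Matrix b c V) β = 0 := by
  ext i j
  simp [matSandwich]

/-- The linear map `x ↦ α x β` on matrices over a vector space. -/
def matSandwichLinear (α : Matrix a b ℂ) (β : Matrix c d ℂ) : Matrix b c V →ₗ[ℂ] Matrix a d V where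
  toFun x := matSandwich α x β
  map_add' x y := by
    ext i j
    simp [matSandwich, Finset.sum_add_distrib]
  map_smul' r x := by
    ext i j
    simp only [matSandwich, of_apply, Matrix.smul_apply, RingHom.id_apply, Finset.smul_sum,
      smul_comm r]

lemma matSandwich_submatrix_equiv {b' c' : Type*} [Fintype b'] [Fintype c'] (g : b' ≃ b)
    (h : c' ≃ c) (α : Matrix a b ℂ) (x : Matrix b c V) (β : Matrix c d ℂ) :
    matSandwich (α.submatrix id g) (x.submatrix g h) (β.submatrix h id) = matSandwich α x β := by
  ext i j
  simp only [matSandwich, of_apply, submatrix_apply, id_eq]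
  rw [g.sum_comp fun k => ∑ l, (α i k * β (h l) j) • x k (h l)]
  exact Finset.sum_congr rfl fun k _ => h.sum_comp fun l => (α i k * β l j) • x k l

lemma matSandwich_fromCols_fromBlocks_fromRows {b' c' : Type*} [Fintype b'] [Fintype c']
    (α : Matrix a b ℂ) (α' : Matrix a b' ℂ) (x : Matrix b c V) (x' : Matrix b' c' V)
    (β : Matrix c d ℂ) (β' : Matrix c' d ℂ) :
    matSandwich (fromCols α α') (fromBlocks x 0 0 x') (fromRows β β') =
      matSandwich α x β + matSandwich α' x' β' := by
  ext i j
  simp [matSandwich]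

lemma matSandwich_fromBlocks_diagonal {a' b' c' d' : Type*} [Fintype b'] [Fintype c']
    (α : Matrix a b ℂ) (α' : Matrix a' b' ℂ) (x : Matrix b c V) (x' : Matrix b' c' V)
    (β : Matrix c d ℂ) (β' : Matrix c' d' ℂ) :
    matSandwich (fromBlocks α 0 0 α') (fromBlocks x 0 0 x') (fromBlocks β 0 0 β') =
      fromBlocks (matSandwich α x β) 0 0 (matSandwich α' x' β') := by
  ext (i | i) (j | j) <;> simp [matSandwich]

end Sandwich

section Blocks

variable {V : Type*} [AddCommGroup V] [Module ℂ V] {m n : ℕ}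

lemma matSandwich_matBlocks {a d : Type*}
    (α : Matrix a (Fin m ⊕ Fin n) ℂ) (x : Matrix (Fin m) (Fin m) V) (y : Matrix (Fin n) (Fin n) V)
    (β : Matrix (Fin m ⊕ Fin n) d ℂ) :
    matSandwich (α.submatrix id finSumFinEquiv.symm) (matBlocks x 0 0 y)
      (β.submatrix finSumFinEquiv.symm id) = matSandwich α (fromBlocks x 0 0 y) β :=
  matSandwich_submatrix_equiv finSumFinEquiv.symm finSumFinEquiv.symm α _ β

/-- The column of scalar matrices `[s 1; t 1]`, completed to a square matrix by zeros. -/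
def scalarColumn (n : ℕ) (s t : ℂ) : Matrix (Fin n ⊕ Fin n) (Fin n ⊕ Fin n) ℂ :=
  fromCols (fromRows (s • 1) (t • 1)) 0

lemma l2_scalarColumn_sq_le (n : ℕ) (s t : ℂ) :
    ‖scalarColumn n s t‖ ^ 2 ≤ ‖s‖ ^ 2 + ‖t‖ ^ 2 := by
  calc ‖scalarColumn n s t‖ ^ 2
      ≤ ‖fromRows (s • (1 : Matrix (Fin n) (Fin n) ℂ)) (t • (1 : Matrix (Fin n) (Fin n) ℂ))‖ ^ 2 +
        ‖(0 : Matrix (Fin n ⊕ Fin n) (Fin n) ℂ)‖ ^ 2 := l2_fromCols_sq_le _ _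
    _ ≤ (‖s • (1 : Matrix (Fin n) (Fin n) ℂ)‖ ^ 2 + ‖t • (1 : Matrix (Fin n) (Fin n) ℂ)‖ ^ 2) + 0 :=
        add_le_add (l2_fromRows_sq_le _ _) (by simp)
    _ ≤ ‖s‖ ^ 2 + ‖t‖ ^ 2 := by
        rw [add_zero]
        gcongr <;> exact l2_smul_one_le _

lemma matBlocks_smul_column (s t : ℂ) (x y : Matrix (Fin n) (Fin n) V) :
    matBlocks (s • x) 0 (t • y) 0 =
      matSandwich ((1 : Matrix (Fin n ⊕ Fin n) (Fin n ⊕ Fin n) ℂ).submatrix finSumFinEquiv.symm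
        finSumFinEquiv.symm) (matBlocks x 0 0 y)
        ((scalarColumn n s t).submatrix finSumFinEquiv.symm finSumFinEquiv.symm) := by
  let one : Matrix (Fin n ⊕ Fin n) (Fin n ⊕ Fin n) ℂ := 1
  have factor : fromBlocks (s • x) 0 (t • y) 0 =
      matSandwich one (fromBlocks x 0 0 y) (scalarColumn n s t) := by
    ext (i | i) (j | j) <;> simp [matSandwich, one, scalarColumn, one_apply]
  refine (congr_arg (reindex finSumFinEquiv finSumFinEquiv) factor).trans ?_
  exact (matSandwich_matBlocks (one.submatrix finSumFinEquiv.symm id) _ _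
    ((scalarColumn n s t).submatrix id finSumFinEquiv.symm)).symm

end Blocks

section ColumnNorm

variable {X : Type*} [NormedAddCommGroup X] [NormedSpace ℂ X] [OperatorSpace X] {m n : ℕ}

lemma matNorm_sandwich_le_of_le_one {α : Matrix (Fin n) (Fin m) ℂ} (hα : ‖α‖ ≤ 1)
    (x : Matrix (Fin m) (Fin m) X) {β : Matrix (Fin m) (Fin n) ℂ} (hβ : ‖β‖ ≤ 1) :
    matNorm n (matSandwich α x β) ≤ matNorm m x := by
  have _nonneg : 0 ≤ matNorm m x := apply_nonneg _ x
  calc matNorm n (matSandwich α x β) ≤ ‖α‖ * matNorm m x * ‖β‖ := matNorm_sandwich_le m n α x β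
    _ ≤ 1 * matNorm m x * 1 := by gcongr
    _ = matNorm m x := by ring

lemma matNorm_submatrix_le (x : Matrix (Fin m) (Fin m) X) {g h : Fin n → Fin m}
    (hg : g.Injective) (hh : h.Injective) : matNorm n (x.submatrix g h) ≤ matNorm m x := by
  rw [← matSandwich_one_submatrix]
  exact matNorm_sandwich_le_of_le_one (l2_one_submatrix_le hg Function.injective_id) x
    (l2_one_submatrix_le Function.injective_id hh)

lemma matNorm_le_colNorm (x y : Matrix (Fin n) (Fin n) X) : matNorm n x ≤ colNorm x y := by
  have e : x = (matBlocks x 0 y 0).submatrix (Fin.castAdd n) (Fin.castAdd n) := by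
    ext i j
    simp [matBlocks]
  conv_lhs => rw [e]
  exact matNorm_submatrix_le _ (Fin.castAdd_injective n n) (Fin.castAdd_injective n n)

lemma colNorm_comm (x y : Matrix (Fin n) (Fin n) X) : colNorm x y = colNorm y x := by
  have le (x y : Matrix (Fin n) (Fin n) X) : colNorm x y ≤ colNorm y x := by
    let swap : Fin (n + n) ≃ Fin (n + n) :=
      (finSumFinEquiv.symm.trans (Equiv.sumComm _ _)).trans finSumFinEquiv
    have e : matBlocks x 0 y 0 = (matBlocks y 0 x 0).submatrix swap id := by
      ext i j
      obtain ⟨i | i, rfl⟩ := finSumFinEquiv.surjective i <;>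
        obtain ⟨j | j, rfl⟩ := finSumFinEquiv.surjective j <;>
        simp only [matBlocks, swap, reindex_apply, submatrix_apply, Equiv.trans_apply,
          Equiv.symm_apply_apply, Equiv.sumComm_apply, Sum.swap_inl, Sum.swap_inr, id_eq,
          fromBlocks_apply₁₁, fromBlocks_apply₁₂, fromBlocks_apply₂₁, fromBlocks_apply₂₂]
    rw [colNorm, e]
    exact matNorm_submatrix_le _ swap.injective Function.injective_id
  exact le_antisymm (le x y) (le y x)

lemma matNorm_inv_smul_self_le_one (x : Matrix (Fin n) (Fin n) X) :
    matNorm n (((matNorm n x)⁻¹ : ℂ) • x) ≤ 1 := by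
  have hx : 0 ≤ matNorm n x := apply_nonneg _ x
  rw [map_smul_eq_mul, norm_inv, Complex.norm_real, Real.norm_of_nonneg hx]
  exact inv_mul_le_one

lemma smul_inv_smul_matNorm (x : Matrix (Fin n) (Fin n) X) :
    (matNorm n x : ℂ) • ((matNorm n x)⁻¹ : ℂ) • x = x := by
  rcases eq_or_ne (matNorm n x) 0 with h | h
  · rw [eq_zero_of_matNorm_eq_zero x h, smul_zero, smul_zero]
  · exact smul_inv_smul₀ (Complex.ofReal_ne_zero.mpr h) x

/- `[x; y] = (x / ‖x‖ ⊕ y / ‖y‖) [‖x‖ 1; ‖y‖ 1]`. -/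
lemma colNorm_sq_le (x y : Matrix (Fin n) (Fin n) X) :
    colNorm x y ^ 2 ≤ matNorm n x ^ 2 + matNorm n y ^ 2 := by
  set s := matNorm n x
  set t := matNorm n y
  have le_norm : colNorm x y ≤ ‖scalarColumn n s t‖ := by
    calc colNorm x y
        = matNorm (n + n) (matBlocks ((s : ℂ) • (s⁻¹ : ℂ) • x) 0 ((t : ℂ) • (t⁻¹ : ℂ) • y) 0) := by
          rw [smul_inv_smul_matNorm, smul_inv_smul_matNorm, colNorm]
      _ ≤ 1 * max (matNorm n ((s⁻¹ : ℂ) • x)) (matNorm n ((t⁻¹ : ℂ) • y)) *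
          ‖scalarColumn n s t‖ := by
        rw [matBlocks_smul_column, ← matNorm_directSum]
        refine (matNorm_sandwich_le _ _ _ _ _).trans ?_
        gcongr
        · exact l2_one_submatrix_le (Equiv.injective _) (Equiv.injective _)
        · exact l2_submatrix_le _ _ _ (Equiv.injective _) (Equiv.injective _)
      _ ≤ 1 * 1 * ‖scalarColumn n s t‖ := by
        gcongr
        exact max_le (matNorm_inv_smul_self_le_one x) (matNorm_inv_smul_self_le_one y)
      _ = ‖scalarColumn n s t‖ := by ring
  calc colNorm x y ^ 2 ≤ ‖scalarColumn n s t‖ ^ 2 :=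
        pow_le_pow_left₀ (apply_nonneg (matNorm _) _) le_norm 2
    _ ≤ s ^ 2 + t ^ 2 := by
        simpa only [Complex.norm_real, Real.norm_eq_abs, sq_abs] using l2_scalarColumn_sq_le n s t

end ColumnNorm

section Uniqueness

variable {E G : Type*} [NormedAddCommGroup E] [NormedSpace ℂ E] [NormedAddCommGroup G]
  [NormedSpace ℂ G] {P : E →ₗ[ℂ] E}

/-- The one-sided Pythagorean inequality for the decomposition of a space by `P`; it holds for
complete left `M`-projections and for the adjoints of complete right `L`-projections. -/
def IsPythagorean (P : E →ₗ[ℂ] E) : Prop :=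
  ∀ u v, ‖P u + (v - P v)‖ ^ 2 ≤ ‖P u‖ ^ 2 + ‖v - P v‖ ^ 2

lemma IsPythagorean.apply_sub_eq_zero (hP : IsPythagorean P) {T : E →ₗ[ℂ] G}
    (hT : ∀ x, ‖T x‖ ≤ ‖x‖) {y v : E} (hPy : P y = y) (hTy : T y = T (v - P v))
    (hy : ‖y‖ ≤ ‖T y‖) : T (v - P v) = 0 := by
  -- `‖T (k y + v - P v)‖ = (k + 1) ‖T y‖` cannot stay below `√(k² ‖y‖² + ‖v - P v‖²)`.
  have growth (k : ℕ) : (2 * k + 1) * ‖T y‖ ^ 2 ≤ ‖v - P v‖ ^ 2 := by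
    have hT_sum : ‖T (k • y + (v - P v))‖ = (k + 1) * ‖T y‖ := by
      rw [map_add, map_nsmul, ← hTy, ← succ_nsmul, RCLike.norm_nsmul ℂ]
      push_cast [nsmul_eq_mul]
      rfl
    have h_sum : ‖k • y + (v - P v)‖ ^ 2 ≤ (k * ‖T y‖) ^ 2 + ‖v - P v‖ ^ 2 := by
      have h := hP (k • y) v
      rw [map_nsmul, hPy] at h
      refine h.trans ?_
      rw [RCLike.norm_nsmul ℂ, nsmul_eq_mul]
      gcongr
    have h := (pow_le_pow_left₀ (norm_nonneg _) (hT (k • y + (v - P v))) 2).trans h_sum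
    rw [hT_sum] at h
    linarith
  rw [← hTy, ← norm_eq_zero, ← sq_eq_zero_iff]
  by_contra h
  have pos : 0 < ‖T y‖ ^ 2 := lt_of_le_of_ne' (by positivity) h
  obtain ⟨k, hk⟩ := exists_nat_gt (‖v - P v‖ ^ 2 / ‖T y‖ ^ 2)
  rw [div_lt_iff₀ pos] at hk
  nlinarith [growth k]

lemma IsPythagorean.eq_of_range_eq {Q : E →ₗ[ℂ] E} (hP : IsPythagorean P) (hPP : P ∘ₗ P = P)
    (hQ : IsContractiveProjection Q) (h : LinearMap.range Q = LinearMap.range P) : P = Q := by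
  have P_fixes {x} (hx : x ∈ LinearMap.range P) : P x = x :=
    (LinearMap.IsIdempotentElem.mem_range_iff hPP).mp hx
  have Q_fixes {x} (hx : x ∈ LinearMap.range P) : Q x = x :=
    (LinearMap.IsIdempotentElem.mem_range_iff hQ.1).mp (h ▸ hx)
  ext v
  have hmem : Q (v - P v) ∈ LinearMap.range P := h ▸ ⟨_, rfl⟩
  have h0 := hP.apply_sub_eq_zero hQ.2 (P_fixes hmem) (Q_fixes hmem)
    (by rw [Q_fixes hmem])
  rw [map_sub, Q_fixes ⟨v, rfl⟩] at h0
  exact (sub_eq_zero.mp h0).symm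

end Uniqueness

section LeftMProjection

variable {X : Type*} [NormedAddCommGroup X] [NormedSpace ℂ X] [OperatorSpace X]
  {P Q : X →ₗ[ℂ] X}

namespace IsCompleteLeftMProjection

lemma isPythagorean (hP : IsCompleteLeftMProjection P) : IsPythagorean P := by
  intro u v
  have hPu : P (P u + (v - P v)) = P u := by
    have h (x) : P (P x) = P x := LinearMap.congr_fun hP.1 x
    rw [map_add, map_sub, h, h, sub_self, add_zero]
  set x := P u + (v - P v)
  have h := colNorm_sq_le (of fun _ _ : Fin 1 => P x) (of fun _ _ : Fin 1 => x - P x)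
  have h1 : colNorm (of fun _ _ : Fin 1 => P x) (of fun _ _ : Fin 1 => x - P x) = ‖x‖ := by
    rw [← matNorm_one x]
    exact (hP.2 1 _).symm
  rw [h1, matNorm_one, matNorm_one, hPu] at h
  rwa [show x - P u = v - P v from add_sub_cancel_left _ _] at h

lemma isContractiveProjection (hP : IsCompleteLeftMProjection P) : IsContractiveProjection P := by
  refine ⟨hP.1, fun x => ?_⟩
  have h := matNorm_le_colNorm (of fun _ _ : Fin 1 => P x) (of fun _ _ : Fin 1 => x - P x)
  rw [matNorm_one] at h
  rw [← matNorm_one x, hP.2]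
  exact h

lemma id_sub (hP : IsCompleteLeftMProjection P) :
    IsCompleteLeftMProjection (LinearMap.id - P) := by
  refine ⟨?_, fun n x => ?_⟩
  · ext x
    have h : P (P x) = P x := LinearMap.congr_fun hP.1 x
    simp [h]
  · rw [hP.2, colNorm_comm]
    have h : x.map (LinearMap.id - P : X →ₗ[ℂ] X) = x - x.map P := rfl
    rw [h, sub_sub_cancel]

lemma eq_of_range_eq (hP : IsCompleteLeftMProjection P) (hQ : IsContractiveProjection Q)
    (h : LinearMap.range Q = LinearMap.range P) : P = Q :=
  hP.isPythagorean.eq_of_range_eq hP.1 hQ h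

end IsCompleteLeftMProjection

end LeftMProjection

section ScalarMatrices

variable {a b : Type*} [Fintype a] [Fintype b] [DecidableEq b]

lemma l2_le_one_of_re_dotProduct_le (M : Matrix a b ℂ)
    (h : ∀ (u : a → ℂ) (v : b → ℂ),
      (u ⬝ᵥ M *ᵥ v).re ≤ (∑ i, ‖u i‖ ^ 2 + ∑ j, ‖v j‖ ^ 2) / 2) : ‖M‖ ≤ 1 := by
  classical
  refine l2_le_of_sq _ _ zero_le_one fun v => ?_
  have hv := h (star (M *ᵥ v)) v
  have re_self : (star (M *ᵥ v) ⬝ᵥ M *ᵥ v).re = ∑ i, ‖(M *ᵥ v) i‖ ^ 2 := by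
    simp_rw [dotProduct, Complex.re_sum, Pi.star_apply, Complex.star_def, Complex.conj_mul',
      ← Complex.ofReal_pow, Complex.ofReal_re]
  simp only [re_self, Pi.star_apply, norm_star] at hv
  linarith

lemma norm_dotProduct_mulVec_le (M : Matrix a b ℂ) {u : a → ℂ} {v : b → ℂ} {C : ℝ}
    (hu : ∑ i, ‖u i‖ ^ 2 ≤ C) (hv : ∑ j, ‖v j‖ ^ 2 ≤ C) : ‖u ⬝ᵥ M *ᵥ v‖ ≤ ‖M‖ * C := by
  classical
  have hC : 0 ≤ C := le_trans (by positivity) hu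
  refine (norm_sum_le _ _).trans ?_
  simp only [norm_mul]
  refine (sq_le_sq₀ (by positivity) (by positivity)).mp ?_
  calc (∑ i, ‖u i‖ * ‖(M *ᵥ v) i‖) ^ 2
      ≤ (∑ i, ‖u i‖ ^ 2) * ∑ i, ‖(M *ᵥ v) i‖ ^ 2 := Finset.sum_mul_sq_le_sq_mul_sq _ _ _
    _ ≤ C * (‖M‖ ^ 2 * C) := by
        gcongr
        exact (sq_le_l2 M v).trans (by gcongr)
    _ = (‖M‖ * C) ^ 2 := by ring

end ScalarMatrices

section Density

open scoped MatrixOrder ComplexOrder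

variable {a b : Type*} [Fintype a] [Fintype b]

lemma re_trace_conjTranspose_mul_self (A : Matrix a b ℂ) :
    (Aᴴ * A).trace.re = ∑ i, ∑ j, ‖A i j‖ ^ 2 := by
  rw [Finset.sum_comm]
  simp only [trace, diag, mul_apply, conjTranspose_apply, Complex.re_sum]
  refine Finset.sum_congr rfl fun _ _ => Finset.sum_congr rfl fun _ _ => ?_
  rw [Complex.star_def, Complex.conj_mul', ← Complex.ofReal_pow, Complex.ofReal_re]

lemma exists_trace_mul_eq (φ : Matrix a a ℂ →ₗ[ℂ] ℂ) :
    ∃ σ : Matrix a a ℂ, ∀ A, (σ * A).trace = φ A := by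
  classical
  refine ⟨of fun j i => φ (single i j 1), fun A => ?_⟩
  conv_rhs => rw [matrix_eq_sum_single A]
  simp only [map_sum, trace, diag, mul_apply, of_apply]
  rw [Finset.sum_comm]
  refine Finset.sum_congr rfl fun i _ => Finset.sum_congr rfl fun j _ => ?_
  rw [mul_comm, ← smul_eq_mul, ← map_smul, smul_single, smul_eq_mul, mul_one]

lemma exists_isHermitian_re_trace_mul_eq (p : Matrix a a ℂ →ₗ[ℝ] ℝ) :
    ∃ ρ : Matrix a a ℂ, ρ.IsHermitian ∧ ∀ A, A.IsHermitian → (ρ * A).trace.re = p A := by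
  classical
  obtain ⟨σ, hσ⟩ := exists_trace_mul_eq (Module.Dual.extendRCLike (𝕜 := ℂ) p)
  have re_trace (A : Matrix a a ℂ) : (σ * A).trace.re = p A := by
    rw [hσ]
    exact Module.Dual.re_extendRCLike_apply (𝕜 := ℂ) p A
  refine ⟨(1 / 2 : ℝ) • (σ + σᴴ), ?_, fun A hA => ?_⟩
  · simp [IsHermitian, add_comm]
  · have re_trace_conj : (σᴴ * A).trace.re = p A := by
      have : σᴴ * A = (A * σ)ᴴ := by rw [conjTranspose_mul, hA.eq]
      rw [this, trace_conjTranspose, trace_mul_comm, Complex.star_def, Complex.conj_re, re_trace]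
    rw [Matrix.smul_mul, add_mul, trace_smul, Complex.smul_re, trace_add, Complex.add_re,
      re_trace, re_trace_conj, smul_eq_mul]
    ring

lemma posSemidef_of_re_trace_mul_nonneg {ρ : Matrix a a ℂ} (hρ : ρ.IsHermitian)
    (h : ∀ x, 0 ≤ (ρ * vecMulVec x (star x)).trace.re) : ρ.PosSemidef := by
  refine .of_dotProduct_mulVec_nonneg hρ fun x => Complex.nonneg_iff.mpr ⟨?_, ?_⟩
  · have hx := h x
    rwa [mul_vecMulVec, trace_vecMulVec, dotProduct_comm] at hx
  · exact (hρ.im_star_dotProduct_mulVec_self x).symm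

lemma exists_isUnit_frobenius_mul_eq [DecidableEq a] {ρ : Matrix a a ℂ} (hρ : ρ.PosSemidef) {δ : ℝ}
    (hδ : 0 < δ) :
    ∃ R : Matrix a a ℂ, IsUnit R ∧ ∀ (m : ℕ) (α : Matrix a (Fin m) ℂ),
      ∑ i, ∑ j, ‖(R * α) i j‖ ^ 2 = (ρ * (α * αᴴ)).trace.re + δ * ∑ i, ∑ j, ‖α i j‖ ^ 2 := by
  have posDef : (ρ + δ • (1 : Matrix a a ℂ)).PosDef :=
    PosDef.posSemidef_add hρ (PosDef.one.smul hδ)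
  obtain ⟨R, hR, hRρ⟩ := CStarAlgebra.isStrictlyPositive_iff_eq_star_mul_self.mp
    posDef.isStrictlyPositive
  refine ⟨R, hR, fun m α => ?_⟩
  have gram : (R * α)ᴴ * (R * α) = αᴴ * (ρ * α) + δ • (αᴴ * α) := by
    rw [conjTranspose_mul, Matrix.mul_assoc, ← Matrix.mul_assoc Rᴴ, ← star_eq_conjTranspose R,
      ← hRρ, Matrix.add_mul, Matrix.mul_add, Matrix.smul_mul, Matrix.one_mul, Matrix.mul_smul]
  rw [← re_trace_conjTranspose_mul_self, ← re_trace_conjTranspose_mul_self, gram, trace_add,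
    Complex.add_re, trace_smul, Complex.smul_re, smul_eq_mul, trace_mul_comm, Matrix.mul_assoc]

/- The perturbation by `ε` serves to make `R` invertible. -/
lemma exists_isUnit_frobenius_dominating {n : ℕ} {p : Matrix (Fin n) (Fin n) ℂ →ₗ[ℝ] ℝ}
    (nonneg : ∀ x, 0 ≤ p (vecMulVec x (star x))) (le_one : p 1 ≤ 1) {ε : ℝ} (hε : 0 < ε) :
    ∃ R : Matrix (Fin n) (Fin n) ℂ, IsUnit R ∧ ∑ i, ∑ j, ‖R i j‖ ^ 2 ≤ 1 + ε ∧
      ∀ (m : ℕ) (α : Matrix (Fin n) (Fin m) ℂ), p (α * αᴴ) ≤ ∑ i, ∑ j, ‖(R * α) i j‖ ^ 2 := by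
  obtain ⟨ρ, hρ, hp⟩ := exists_isHermitian_re_trace_mul_eq p
  have hρ_pos : ρ.PosSemidef := posSemidef_of_re_trace_mul_nonneg hρ fun x => by
    rw [hp _ (by simp [IsHermitian, conjTranspose_vecMulVec])]
    exact nonneg x
  obtain ⟨R, hR, key⟩ := exists_isUnit_frobenius_mul_eq hρ_pos (δ := ε / (n + 1)) (by positivity)
  simp only [hp _ (isHermitian_mul_conjTranspose_self _)] at key
  refine ⟨R, hR, ?_, fun m α => ?_⟩
  · have sum_one : ∑ i : Fin n, ∑ j : Fin n, ‖(1 : Matrix (Fin n) (Fin n) ℂ) i j‖ ^ 2 = n := by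
      simp [one_apply, apply_ite norm, ite_pow]
    have h := key n 1
    rw [Matrix.mul_one, conjTranspose_one, Matrix.mul_one, sum_one] at h
    have : ε / (n + 1) * n ≤ ε := by
      rw [div_mul_eq_mul_div, div_le_iff₀ (by positivity)]
      nlinarith
    linarith
  · rw [key]
    exact le_add_of_nonneg_right (by positivity)

end Density

section Evaluation

variable {V F : Type*} [FunLike F V ℂ] {a b c d : Type*}

/-- The scalar matrix `[f_ij(y_kl)]`, which is `matPairing f y` for matrices of continuous
functionals. -/
def matEval (f : Matrix a b F) (y : Matrix c d V) : Matrix (a × c) (b × d) ℂ :=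
  of fun p q => f p.1 q.1 (y p.2 q.2)

variable [AddCommGroup V] [Module ℂ V] [LinearMapClass F ℂ V ℂ] [Fintype c] [Fintype d]

lemma dotProduct_matEval_mulVec [Fintype a] [Fintype b] (f : Matrix a b F) (y : Matrix c d V)
    (α : Matrix a c ℂ) (β : Matrix d b ℂ) :
    (fun p => α p.1 p.2) ⬝ᵥ matEval f y *ᵥ (fun q => β q.2 q.1) =
      ∑ i, ∑ j, f i j (matSandwich α y β i j) := by
  simp only [mulVec, dotProduct, matEval, of_apply, Fintype.sum_prod_type, matSandwich, map_sum,
    map_smul, smul_eq_mul, Finset.mul_sum]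
  refine Finset.sum_congr rfl fun i _ => ?_
  rw [Finset.sum_comm]
  refine Finset.sum_congr rfl fun j _ => Finset.sum_congr rfl fun k _ =>
    Finset.sum_congr rfl fun l _ => ?_
  ring

lemma matEval_matSandwich {c' d' : Type*} [Fintype a] [Fintype b] [DecidableEq a]
    [DecidableEq b] (f : Matrix a b F) (α : Matrix c' c ℂ) (y : Matrix c d V)
    (β : Matrix d d' ℂ) :
    matEval f (matSandwich α y β) =
      ((1 : Matrix a a ℂ) ⊗ₖ α) * matEval f y * ((1 : Matrix b b ℂ) ⊗ₖ β) := by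
  ext p q
  simp only [matEval, matSandwich, of_apply, map_sum, map_smul, smul_eq_mul, mul_apply,
    kroneckerMap_apply, Fintype.sum_prod_type, one_apply, ite_mul, mul_ite, zero_mul, mul_zero,
    one_mul, Finset.sum_mul, Finset.sum_ite_irrel, Finset.sum_const_zero, Finset.sum_ite_eq,
    Finset.sum_ite_eq', Finset.mem_univ, if_true]
  rw [Finset.sum_comm]
  refine Finset.sum_congr rfl fun _ _ => Finset.sum_congr rfl fun _ _ => ?_
  ring

end Evaluation

/-- A family of sets `B m ⊆ M_m(V)` behaving like the unit balls of a matrix seminorm: it is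
absorbing and closed under direct sums and under `y ↦ α y β` for scalar contractions `α`, `β`. -/
structure IsMatrixConvex {V : Type*} [AddCommGroup V] [Module ℂ V]
    (B : ∀ m : ℕ, Set (Matrix (Fin m) (Fin m) V)) : Prop where
  directSum : ∀ {m n : ℕ} {x : Matrix (Fin m) (Fin m) V} {y : Matrix (Fin n) (Fin n) V},
    x ∈ B m → y ∈ B n → matBlocks x 0 0 y ∈ B (m + n)
  sandwich : ∀ {m n : ℕ} {α : Matrix (Fin n) (Fin m) ℂ} {x : Matrix (Fin m) (Fin m) V}
    {β : Matrix (Fin m) (Fin n) ℂ}, ‖α‖ ≤ 1 → ‖β‖ ≤ 1 → x ∈ B m → matSandwich α x β ∈ B n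
  absorbing : ∀ {m : ℕ} (x : Matrix (Fin m) (Fin m) V), ∃ c : ℝ, 0 < c ∧ (c : ℂ) • x ∈ B m

namespace IsMatrixConvex

variable {V : Type*} [AddCommGroup V] [Module ℂ V] {B : ∀ m : ℕ, Set (Matrix (Fin m) (Fin m) V)}

lemma zero_mem (hB : IsMatrixConvex B) (m : ℕ) : (0 : Matrix (Fin m) (Fin m) V) ∈ B m := by
  obtain ⟨c, -, hc⟩ := hB.absorbing (0 : Matrix (Fin m) (Fin m) V)
  rwa [smul_zero] at hc

variable {m n : ℕ} {x₀ : Matrix (Fin n) (Fin n) V}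

lemma mul_le_norm_mul_norm (hB : IsMatrixConvex B) {N : ℝ}
    (hN : ∀ c : ℝ, 0 < c → (c : ℂ) • x₀ ∈ B n → c * N ≤ 1) {t : ℝ} (ht : 0 < t)
    {α : Matrix (Fin n) (Fin m) ℂ} {y : Matrix (Fin m) (Fin m) V} {β : Matrix (Fin m) (Fin n) ℂ}
    (hy : y ∈ B m) (h : matSandwich α y β = (t : ℂ) • x₀) : t * N ≤ ‖α‖ * ‖β‖ := by
  refine le_mul_of_forall_lt₀ fun r hr s hs => ?_
  have hr0 : 0 < r := (norm_nonneg α).trans_lt hr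
  have hs0 : 0 < s := (norm_nonneg β).trans_lt hs
  have contraction {a b : ℕ} {γ : Matrix (Fin a) (Fin b) ℂ} {r : ℝ} (hr0 : 0 < r)
      (hγ : ‖γ‖ < r) : ‖((r⁻¹ : ℝ) : ℂ) • γ‖ ≤ 1 := by
    rw [norm_smul, Complex.norm_real, Real.norm_of_nonneg (inv_nonneg.mpr hr0.le)]
    exact inv_mul_le_one_of_le₀ hγ.le hr0.le
  have hmem := hB.sandwich (contraction hr0 hr) (contraction hs0 hs) hy
  rw [matSandwich_smul_smul, h, smul_smul, ← Complex.ofReal_mul, ← Complex.ofReal_mul] at hmem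
  have hle := hN _ (by positivity) hmem
  rwa [← mul_inv, mul_assoc, inv_mul_le_iff₀ (by positivity), mul_one] at hle

/-- The values `‖A + αα*‖ + ‖D + β*β‖` over all factorizations `x = α y β` with `y` in the unit
ball `B m`, for a triple `(x, A, D)`. -/
def factorizationBounds (B : ∀ m : ℕ, Set (Matrix (Fin m) (Fin m) V))
    (u : Matrix (Fin n) (Fin n) V × Matrix (Fin n) (Fin n) ℂ × Matrix (Fin n) (Fin n) ℂ) : Set ℝ :=
  {r | ∃ (m : ℕ) (α : Matrix (Fin n) (Fin m) ℂ) (y : Matrix (Fin m) (Fin m) V)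
    (β : Matrix (Fin m) (Fin n) ℂ), y ∈ B m ∧ matSandwich α y β = u.1 ∧
    r = ‖u.2.1 + α * αᴴ‖ + ‖u.2.2 + βᴴ * β‖}

/-- The infimum of `factorizationBounds`, a sublinear functional: this linearizes the quadratic
dependence of `‖α‖ ‖β‖` on a factorization, so that the Hahn–Banach theorem applies. -/
def factorizationGauge (B : ∀ m : ℕ, Set (Matrix (Fin m) (Fin m) V))
    (u : Matrix (Fin n) (Fin n) V × Matrix (Fin n) (Fin n) ℂ × Matrix (Fin n) (Fin n) ℂ) : ℝ :=
  sInf (factorizationBounds B u)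

section Gauge

variable (u w : Matrix (Fin n) (Fin n) V × Matrix (Fin n) (Fin n) ℂ × Matrix (Fin n) (Fin n) ℂ)

lemma factorizationBounds_nonneg {r : ℝ} (hr : r ∈ factorizationBounds B u) : 0 ≤ r := by
  obtain ⟨m, α, y, β, -, -, rfl⟩ := hr
  positivity

variable {u} in
lemma factorizationGauge_le {α : Matrix (Fin n) (Fin m) ℂ} {y : Matrix (Fin m) (Fin m) V}
    {β : Matrix (Fin m) (Fin n) ℂ} (hy : y ∈ B m) (h : matSandwich α y β = u.1) :
    factorizationGauge B u ≤ ‖u.2.1 + α * αᴴ‖ + ‖u.2.2 + βᴴ * β‖ :=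
  csInf_le ⟨0, fun _ => factorizationBounds_nonneg u⟩ ⟨m, α, y, β, hy, h, rfl⟩

lemma factorizationBounds_nonempty (hB : IsMatrixConvex B) :
    (factorizationBounds B u).Nonempty := by
  obtain ⟨c, hc, hx⟩ := hB.absorbing u.1
  refine ⟨_, n, (c : ℂ)⁻¹ • 1, (c : ℂ) • u.1, (1 : ℂ) • 1, hx, ?_, rfl⟩
  rw [matSandwich_smul_smul, matSandwich_one_one, mul_one,
    inv_smul_smul₀ (Complex.ofReal_ne_zero.mpr hc.ne')]

lemma mul_mem_factorizationBounds {c : ℝ} (hc : 0 ≤ c) {r : ℝ}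
    (hr : r ∈ factorizationBounds B u) : c * r ∈ factorizationBounds B (c • u) := by
  obtain ⟨m, α, y, β, hy, hu, rfl⟩ := hr
  have hs : ((√c : ℝ) : ℂ) * ((√c : ℝ) : ℂ) = c := by
    rw [← Complex.ofReal_mul, Real.mul_self_sqrt hc]
  refine ⟨m, ((√c : ℝ) : ℂ) • α, y, ((√c : ℝ) : ℂ) • β, hy, ?_, ?_⟩
  · rw [matSandwich_smul_smul, hu, hs]
    rfl
  · have left : (c • u).2.1 + ((√c : ℝ) : ℂ) • α * (((√c : ℝ) : ℂ) • α)ᴴ =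
        c • (u.2.1 + α * αᴴ) := by
      rw [conjTranspose_smul, Matrix.smul_mul, Matrix.mul_smul, smul_smul, Complex.star_def,
        Complex.conj_ofReal, hs, smul_add]
      rfl
    have right : (c • u).2.2 + (((√c : ℝ) : ℂ) • β)ᴴ * ((√c : ℝ) : ℂ) • β =
        c • (u.2.2 + βᴴ * β) := by
      rw [conjTranspose_smul, Matrix.smul_mul, Matrix.mul_smul, smul_smul, Complex.star_def,
        Complex.conj_ofReal, hs, smul_add]
      rfl
    rw [left, right, norm_smul, norm_smul, Real.norm_of_nonneg hc, mul_add]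

lemma factorizationGauge_smul_le (hB : IsMatrixConvex B) {c : ℝ} (hc : 0 < c) :
    factorizationGauge B (c • u) ≤ c * factorizationGauge B u := by
  rw [mul_comm, ← div_le_iff₀ hc]
  refine le_csInf (factorizationBounds_nonempty u hB) fun r hr => ?_
  rw [div_le_iff₀ hc, mul_comm]
  exact csInf_le ⟨0, fun _ => factorizationBounds_nonneg _⟩ (mul_mem_factorizationBounds u hc.le hr)

lemma factorizationGauge_smul (hB : IsMatrixConvex B) {c : ℝ} (hc : 0 < c) :
    factorizationGauge B (c • u) = c * factorizationGauge B u := by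
  refine le_antisymm (factorizationGauge_smul_le u hB hc) ?_
  have h := factorizationGauge_smul_le (c • u) hB (inv_pos.mpr hc)
  rwa [inv_smul_smul₀ hc.ne', ← div_eq_inv_mul, le_div_iff₀ hc, mul_comm] at h

lemma factorizationGauge_add_le (hB : IsMatrixConvex B) :
    factorizationGauge B (u + w) ≤ factorizationGauge B u + factorizationGauge B w := by
  rw [← sub_le_iff_le_add]
  refine le_csInf (factorizationBounds_nonempty u hB) fun r hr => ?_
  rw [sub_le_comm]
  refine le_csInf (factorizationBounds_nonempty w hB) fun r' hr' => ?_
  rw [sub_le_iff_le_add']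
  obtain ⟨m, α, y, β, hy, hu, rfl⟩ := hr
  obtain ⟨m', α', y', β', hy', hw, rfl⟩ := hr'
  have hle := factorizationGauge_le (u := u + w)
    (α := (fromCols α α').submatrix id finSumFinEquiv.symm)
    (β := (fromRows β β').submatrix finSumFinEquiv.symm id) (hB.directSum hy hy') (by
      rw [matSandwich_matBlocks, matSandwich_fromCols_fromBlocks_fromRows, hu, hw]
      rfl)
  rw [conjTranspose_submatrix, conjTranspose_submatrix, submatrix_mul_equiv, submatrix_mul_equiv,
    submatrix_id_id, submatrix_id_id, conjTranspose_fromCols_eq_fromRows_conjTranspose,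
    conjTranspose_fromRows_eq_fromCols_conjTranspose, fromCols_mul_fromRows, fromCols_mul_fromRows,
    Prod.snd_add, Prod.fst_add, Prod.snd_add, add_add_add_comm u.2.1, add_add_add_comm u.2.2]
    at hle
  linarith [norm_add_le (u.2.1 + α * αᴴ) (w.2.1 + α' * α'ᴴ),
    norm_add_le (u.2.2 + βᴴ * β) (w.2.2 + β'ᴴ * β')]

end Gauge

/- `2 ‖α‖ ‖β‖ ≤ ‖αα*‖ + ‖β*β‖`. -/
lemma mul_two_mul_le_factorizationGauge (hB : IsMatrixConvex B) {N : ℝ} (hN₀ : 0 ≤ N)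
    (hN : ∀ c : ℝ, 0 < c → (c : ℂ) • x₀ ∈ B n → c * N ≤ 1) (t : ℝ) :
    t * (2 * N) ≤ factorizationGauge B (t • (x₀, 0, 0)) := by
  rcases le_or_gt t 0 with ht | ht
  · exact (mul_nonpos_of_nonpos_of_nonneg ht (by positivity)).trans
      (Real.sInf_nonneg fun _ => factorizationBounds_nonneg _)
  · refine le_csInf (factorizationBounds_nonempty _ hB) ?_
    rintro r ⟨m, α, y, β, hy, h, rfl⟩
    have hle := hB.mul_le_norm_mul_norm hN ht hy h
    simp only [Prod.smul_snd, Prod.smul_fst, smul_zero, zero_add, l2_mul_conjTranspose_self,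
      l2_opNorm_conjTranspose_mul_self]
    linarith [two_mul_le_add_sq ‖α‖ ‖β‖]

lemma exists_factorization_functional (hB : IsMatrixConvex B) {N : ℝ} (hN₀ : 0 < N)
    (hN : ∀ c : ℝ, 0 < c → (c : ℂ) • x₀ ∈ B n → c * N ≤ 1) :
    ∃ (φ : Matrix (Fin n) (Fin n) V →ₗ[ℝ] ℝ) (p q : Matrix (Fin n) (Fin n) ℂ →ₗ[ℝ] ℝ),
      φ x₀ = 2 * N ∧ (∀ A, p A ≤ ‖A‖) ∧ (∀ A, q A ≤ ‖A‖) ∧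
      ∀ (m : ℕ) (α : Matrix (Fin n) (Fin m) ℂ) (y : Matrix (Fin m) (Fin m) V)
        (β : Matrix (Fin m) (Fin n) ℂ), y ∈ B m →
          φ (matSandwich α y β) ≤ p (α * αᴴ) + q (βᴴ * β) := by
  let u₀ : Matrix (Fin n) (Fin n) V × Matrix (Fin n) (Fin n) ℂ × Matrix (Fin n) (Fin n) ℂ :=
    (x₀, 0, 0)
  have hu₀ : u₀ ≠ 0 := fun h => by
    have hx₀ : x₀ = 0 := congr_arg Prod.fst h
    have := hN (2 / N) (by positivity) (by rw [hx₀, smul_zero]; exact hB.zero_mem n)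
    rw [div_mul_cancel₀ _ hN₀.ne'] at this
    norm_num at this
  obtain ⟨G, hG, hG_le⟩ := exists_extension_of_le_sublinear
    (LinearPMap.mkSpanSingleton (K := ℝ) u₀ (2 * N) hu₀) (factorizationGauge B)
    (fun c hc u => factorizationGauge_smul u hB hc) (fun u w => factorizationGauge_add_le u w hB)
    (by
      rintro ⟨u, hu⟩
      obtain ⟨t, rfl⟩ := Submodule.mem_span_singleton.mp hu
      exact (LinearPMap.mkSpanSingleton'_apply _ _ _ t hu).trans_le
        (hB.mul_two_mul_le_factorizationGauge hN₀.le hN t))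
  have le_norm (A D : Matrix (Fin n) (Fin n) ℂ) : G (0, A, D) ≤ ‖A‖ + ‖D‖ := by
    simpa using (hG_le _).trans (factorizationGauge_le (u := (0, A, D)) (α := 0) (β := 0)
      (hB.zero_mem n) (matSandwich_zero _ _))
  refine ⟨G ∘ₗ .inl ℝ _ _, G ∘ₗ .inr ℝ _ _ ∘ₗ .inl ℝ _ _, G ∘ₗ .inr ℝ _ _ ∘ₗ .inr ℝ _ _, ?_,
    fun A => by simpa using le_norm A 0, fun D => by simpa using le_norm 0 D,
    fun m α y β hy => ?_⟩
  · have h := hG ⟨u₀, Submodule.mem_span_singleton_self _⟩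
    rwa [LinearPMap.mkSpanSingleton_apply] at h
  · have hle := (hG_le (matSandwich α y β, -(α * αᴴ), -(βᴴ * β))).trans
      (factorizationGauge_le (α := α) (β := β) hy rfl)
    have split : (matSandwich α y β, -(α * αᴴ), -(βᴴ * β)) =
        (matSandwich α y β, 0, 0) - (0, α * αᴴ, 0) - (0, 0, βᴴ * β) := by simp
    rw [split, map_sub, map_sub] at hle
    simp only [Prod.fst_sub, Prod.snd_sub, sub_zero, zero_sub, neg_add_cancel, norm_zero,
      add_zero] at hle
    change G (matSandwich α y β, 0, 0) ≤ G (0, α * αᴴ, 0) + G (0, 0, βᴴ * β)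
    linarith

lemma exists_frobenius_dominated_functional (hB : IsMatrixConvex B) {N : ℝ} (hN₀ : 0 < N)
    (hN : ∀ c : ℝ, 0 < c → (c : ℂ) • x₀ ∈ B n → c * N ≤ 1) {ε : ℝ} (hε : 0 < ε) :
    ∃ (φ : Matrix (Fin n) (Fin n) V →ₗ[ℂ] ℂ) (R S : Matrix (Fin n) (Fin n) ℂ),
      (φ x₀).re = 2 * N ∧ IsUnit R ∧ IsUnit S ∧
      ∑ i, ∑ j, ‖R i j‖ ^ 2 ≤ 1 + ε ∧ ∑ i, ∑ j, ‖S i j‖ ^ 2 ≤ 1 + ε ∧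
      ∀ (m : ℕ) (α : Matrix (Fin n) (Fin m) ℂ) (y : Matrix (Fin m) (Fin m) V)
        (β : Matrix (Fin m) (Fin n) ℂ), y ∈ B m → (φ (matSandwich α y β)).re ≤
          ∑ i, ∑ j, ‖(R * α) i j‖ ^ 2 + ∑ i, ∑ j, ‖(S * βᴴ) i j‖ ^ 2 := by
  obtain ⟨φ, p, q, hφ, hp, hq, hle⟩ := hB.exists_factorization_functional hN₀ hN
  have replicateCol_mul (x : Fin n → ℂ) :
      replicateCol (Fin 1) x * (replicateCol (Fin 1) x)ᴴ = vecMulVec x (star x) := by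
    ext i j
    simp [mul_apply, vecMulVec_apply]
  have hp₀ (x : Fin n → ℂ) : 0 ≤ p (vecMulVec x (star x)) := by
    have h := hle 1 (replicateCol (Fin 1) x) 0 0 (hB.zero_mem 1)
    rwa [matSandwich_zero, map_zero, Matrix.mul_zero, map_zero, add_zero,
      replicateCol_mul] at h
  have hq₀ (x : Fin n → ℂ) : 0 ≤ q (vecMulVec x (star x)) := by
    have h := hle 1 0 0 (replicateCol (Fin 1) x)ᴴ (hB.zero_mem 1)
    rwa [matSandwich_zero, map_zero, Matrix.zero_mul, map_zero, zero_add,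
      conjTranspose_conjTranspose, replicateCol_mul] at h
  obtain ⟨R, hR, hR_le, hRp⟩ :=
    exists_isUnit_frobenius_dominating hp₀ ((hp 1).trans l2_one_le) hε
  obtain ⟨S, hS, hS_le, hSq⟩ :=
    exists_isUnit_frobenius_dominating hq₀ ((hq 1).trans l2_one_le) hε
  have re_extend (x : Matrix (Fin n) (Fin n) V) :
      (Module.Dual.extendRCLike (𝕜 := ℂ) φ x).re = φ x :=
    Module.Dual.re_extendRCLike_apply (𝕜 := ℂ) φ x
  refine ⟨Module.Dual.extendRCLike (𝕜 := ℂ) φ, R, S, (re_extend x₀).trans hφ, hR, hS, hR_le, hS_le,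
    fun m α y β hy => (re_extend _).trans_le ?_⟩
  have hβ := hSq m βᴴ
  rw [conjTranspose_conjTranspose] at hβ
  exact (hle m α y β hy).trans (add_le_add (hRp m α) hβ)

lemma exists_norm_matEval_le_one (hB : IsMatrixConvex B) {N : ℝ} (hN₀ : 0 < N)
    (hN : ∀ c : ℝ, 0 < c → (c : ℂ) • x₀ ∈ B n → c * N ≤ 1) {ε : ℝ} (hε : 0 < ε) :
    ∃ f : Matrix (Fin n) (Fin n) (V →ₗ[ℂ] ℂ),
      (∀ (m : ℕ) (y : Matrix (Fin m) (Fin m) V), y ∈ B m → ‖matEval f y‖ ≤ 1) ∧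
      N ≤ ‖matEval f x₀‖ * (1 + ε) := by
  obtain ⟨φ, R, S, hφ, hR, hS, hR_le, hS_le, hle⟩ :=
    hB.exists_frobenius_dominated_functional hN₀ hN hε
  rw [Matrix.isUnit_iff_isUnit_det] at hR hS
  let ψ : Matrix (Fin n) (Fin n) V →ₗ[ℂ] ℂ := φ ∘ₗ matSandwichLinear R⁻¹ S⁻¹ᴴ
  let f : Matrix (Fin n) (Fin n) (V →ₗ[ℂ] ℂ) :=
    of fun i j => (1 / 2 : ℂ) • ψ ∘ₗ singleLinearMap ℂ i j
  have sum_f (x : Matrix (Fin n) (Fin n) V) : ∑ i, ∑ j, f i j (x i j) = 1 / 2 * ψ x := by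
    conv_rhs => rw [matrix_eq_sum_single x]
    simp [f, Finset.mul_sum]
  have re_half (z : ℂ) : (1 / 2 * z).re = z.re / 2 := by
    simp [div_eq_inv_mul]
  refine ⟨f, fun m y hy => l2_le_one_of_re_dotProduct_le _ fun u v => ?_, ?_⟩
  · have h := hle m (R⁻¹ * of fun i k => u (i, k)) y ((of fun l j => v (j, l)) * S⁻¹ᴴ) hy
    rw [conjTranspose_mul, conjTranspose_conjTranspose, mul_nonsing_inv_cancel_left _ _ hR,
      mul_nonsing_inv_cancel_left _ _ hS, ← matSandwich_matSandwich] at h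
    have eq := dotProduct_matEval_mulVec f y (of fun i k => u (i, k)) (of fun l j => v (j, l))
    simp only [of_apply, Prod.mk.eta] at eq
    rw [eq, sum_f, re_half, Fintype.sum_prod_type, Fintype.sum_prod_type]
    simp only [conjTranspose_apply, norm_star, of_apply] at h
    gcongr
    exact h
  · have h := norm_dotProduct_mulVec_le (matEval f x₀) (u := fun p => R p.1 p.2)
      (v := fun q => Sᴴ q.2 q.1) (C := 1 + ε) (by rwa [Fintype.sum_prod_type])
      (by simpa [Fintype.sum_prod_type] using hS_le)
    rw [dotProduct_matEval_mulVec f x₀ R Sᴴ, sum_f] at h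
    have hψ : ψ (matSandwich R x₀ Sᴴ) = φ x₀ := by
      change φ (matSandwich _ (matSandwich R x₀ Sᴴ) _) = _
      rw [matSandwich_matSandwich, nonsing_inv_mul _ hR, ← conjTranspose_mul,
        nonsing_inv_mul _ hS, conjTranspose_one, matSandwich_one_one]
    have := (Complex.re_le_norm _).trans h
    rw [hψ, re_half, hφ] at this
    linarith

theorem le_of_forall_norm_matEval_le (hB : IsMatrixConvex B) {N C : ℝ}
    (hN : ∀ c : ℝ, 0 < c → (c : ℂ) • x₀ ∈ B n → c * N ≤ 1)
    (hC : ∀ f : Matrix (Fin n) (Fin n) (V →ₗ[ℂ] ℂ),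
      (∀ (m : ℕ) (y : Matrix (Fin m) (Fin m) V), y ∈ B m → ‖matEval f y‖ ≤ 1) →
        ‖matEval f x₀‖ ≤ C) : N ≤ C := by
  have hC₀ : 0 ≤ C := (norm_nonneg _).trans (hC 0 fun m y _ => norm_zero.trans_le zero_le_one)
  rcases le_or_gt N 0 with hN₀ | hN₀
  · exact hN₀.trans hC₀
  refine (le_mul_of_forall_lt₀ fun r hr s hs => ?_).trans_eq (mul_one C)
  obtain ⟨f, hf, hNf⟩ := hB.exists_norm_matEval_le_one hN₀ hN (sub_pos.mpr hs)
  rw [add_sub_cancel] at hNf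
  exact hNf.trans (mul_le_mul_of_nonneg_right ((hC f hf).trans hr.le) (zero_le_one.trans hs.le))

end IsMatrixConvex

section ScalarMatrices

variable {a b c d : Type*} [Fintype a] [Fintype b] [Fintype c] [Fintype d]

lemma l2_entry_le [DecidableEq b] (A : Matrix a b ℂ) (i : a) (j : b) : ‖A i j‖ ≤ ‖A‖ := by
  classical
  simpa using norm_dotProduct_mulVec_le A (u := Pi.single i 1) (v := Pi.single j 1) (C := 1)
    (by simp [Pi.single_apply, apply_ite]) (by simp [Pi.single_apply, apply_ite])

lemma l2_submatrix_equiv [DecidableEq b] [DecidableEq d] (A : Matrix a b ℂ) (e : c ≃ a)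
    (e' : d ≃ b) : ‖A.submatrix e e'‖ = ‖A‖ := by
  classical
  refine le_antisymm (l2_submatrix_le A e e' e.injective e'.injective) ?_
  simpa using l2_submatrix_le (A.submatrix e e') e.symm e'.symm e.symm.injective e'.symm.injective

end ScalarMatrices

section Duality

variable {X : Type*} [NormedAddCommGroup X] [NormedSpace ℂ X] [OperatorSpace X] {m n : ℕ}

lemma norm_matPairing_le (f : Matrix (Fin n) (Fin n) (StrongDual ℂ X))
    (x : Matrix (Fin m) (Fin m) X) : ‖matPairing f x‖ ≤ matNorm n f * matNorm m x := by
  have smul (c : ℂ) (y : Matrix (Fin m) (Fin m) X) :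
      matPairing f (c • y) = c • matPairing f y := by
    ext p q
    exact map_smul (f p.1 q.1) c (y p.2 q.2)
  have hx : 0 ≤ matNorm m x := apply_nonneg _ x
  calc ‖matPairing f x‖
      = matNorm m x * ‖matPairing f (((matNorm m x)⁻¹ : ℂ) • x)‖ := by
        conv_lhs => rw [← smul_inv_smul_matNorm x, smul, norm_smul, Complex.norm_real,
          Real.norm_of_nonneg hx]
    _ ≤ matNorm m x * matNorm n f :=
        mul_le_mul_of_nonneg_left
          (norm_matPairing_le_sSup f _ (matNorm_inv_smul_self_le_one x)) hx
    _ = matNorm n f * matNorm m x := mul_comm _ _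

lemma exists_matNorm_le_one_of_norm_matEval_le_one {f : Matrix (Fin n) (Fin n) (X →ₗ[ℂ] ℂ)}
    (hf : ∀ (m : ℕ) (x : Matrix (Fin m) (Fin m) X), matNorm m x ≤ 1 → ‖matEval f x‖ ≤ 1) :
    ∃ g : Matrix (Fin n) (Fin n) (StrongDual ℂ X),
      (∀ i j v, g i j v = f i j v) ∧ matNorm n g ≤ 1 := by
  have bound (i j : Fin n) (v : X) : ‖f i j v‖ ≤ 1 * ‖v‖ := by
    rw [← div_one (1 : ℝ)]
    refine LinearMap.bound_of_ball_bound' one_pos 1 (f i j) (fun z hz => ?_) v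
    refine (l2_entry_le (matEval f (of fun _ _ : Fin 1 => z)) (i, 0) (j, 0)).trans (hf 1 _ ?_)
    rwa [matNorm_one, ← mem_closedBall_zero_iff]
  exact ⟨of fun i j => (f i j).mkContinuous 1 (bound i j), fun _ _ _ => rfl,
    sSup_dualNormSet_le _ _ zero_le_one hf⟩

lemma isMatrixConvex_matNorm_le_one :
    IsMatrixConvex fun m => {x : Matrix (Fin m) (Fin m) X | matNorm m x ≤ 1} where
  directSum hx hy := (matNorm_directSum _ _ _ _).trans_le (max_le hx hy)
  sandwich hα hβ hx := (matNorm_sandwich_le_of_le_one hα _ hβ).trans hx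
  absorbing {m} x := by
    have : 0 ≤ matNorm m x := apply_nonneg _ x
    refine ⟨(matNorm m x + 1)⁻¹, by positivity, ?_⟩
    rw [Set.mem_ofPred_eq, map_smul_eq_mul, Complex.norm_real, Real.norm_of_nonneg (by positivity)]
    exact inv_mul_le_one_of_le₀ (by linarith) (by positivity)

lemma matNorm_le_of_forall_norm_matPairing_le {x : Matrix (Fin n) (Fin n) X} {C : ℝ}
    (h : ∀ f : Matrix (Fin n) (Fin n) (StrongDual ℂ X), matNorm n f ≤ 1 → ‖matPairing f x‖ ≤ C) :
    matNorm n x ≤ C := by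
  refine isMatrixConvex_matNorm_le_one.le_of_forall_norm_matEval_le (x₀ := x) (fun c hc hx => ?_)
    fun f hf => ?_
  · rwa [Set.mem_ofPred_eq, map_smul_eq_mul, Complex.norm_real, Real.norm_of_nonneg hc.le] at hx
  · obtain ⟨g, hg, hg_le⟩ := exists_matNorm_le_one_of_norm_matEval_le_one hf
    have e : matEval f x = matPairing g x := by
      ext p q
      exact (hg _ _ _).symm
    exact e ▸ h g hg_le

variable (X) in
theorem isCompleteIsometry_inclusionInDoubleDual :
    IsCompleteIsometry (F := StrongDual ℂ (StrongDual ℂ X))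
      (NormedSpace.inclusionInDoubleDual ℂ X).toLinearMap := by
  intro n x
  have flip (m : ℕ) (f : Matrix (Fin m) (Fin m) (StrongDual ℂ X)) :
      ‖matPairing (x.map (NormedSpace.inclusionInDoubleDual ℂ X)) f‖ = ‖matPairing f x‖ :=
    l2_submatrix_equiv (matPairing f x) (Equiv.prodComm _ _) (Equiv.prodComm _ _)
  refine le_antisymm (sSup_dualNormSet_le _ _ (apply_nonneg _ _) fun m f hf => ?_)
    (matNorm_le_of_forall_norm_matPairing_le fun f hf => ?_)
  · exact (flip m f).trans_le ((norm_matPairing_le f x).trans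
      (mul_le_of_le_one_left (apply_nonneg _ _) hf))
  · rw [← flip]
    exact norm_matPairing_le_sSup _ f hf

end Duality

section CompleteIsometry

variable {X Y : Type*} [NormedAddCommGroup X] [NormedSpace ℂ X] [OperatorSpace X]
  [NormedAddCommGroup Y] [NormedSpace ℂ Y] [OperatorSpace Y] {e : X →ₗ[ℂ] Y}

namespace IsCompleteIsometry

lemma norm_apply (he : IsCompleteIsometry e) (x : X) : ‖e x‖ = ‖x‖ := by
  rw [← matNorm_one, ← matNorm_one]
  exact he 1 (of fun _ _ => x)

lemma injective (he : IsCompleteIsometry e) : Function.Injective e :=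
  (AddMonoidHomClass.isometry_of_norm e he.norm_apply).injective

lemma colNorm_map (he : IsCompleteIsometry e) {n : ℕ} (x y : Matrix (Fin n) (Fin n) X) :
    colNorm (x.map e) (y.map e) = colNorm x y := by
  have map_matBlocks : matBlocks (x.map e) 0 (y.map e) 0 = (matBlocks x 0 y 0).map e := by
    simp only [matBlocks, reindex_apply, ← submatrix_map, fromBlocks_map,
      Matrix.map_zero _ (map_zero e)]
  rw [colNorm, map_matBlocks, he]
  rfl

end IsCompleteIsometry

lemma IsCompleteLeftMProjection.of_isCompleteIsometry {P : Y →ₗ[ℂ] Y} {Q : X →ₗ[ℂ] X}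
    (hP : IsCompleteLeftMProjection P) (he : IsCompleteIsometry e)
    (h : ∀ x, P (e x) = e (Q x)) : IsCompleteLeftMProjection Q := by
  refine ⟨LinearMap.ext fun x => he.injective ?_, fun n x => ?_⟩
  · rw [LinearMap.comp_apply, ← h, ← h]
    exact LinearMap.congr_fun hP.1 (e x)
  · have hPQ : (x.map e).map P = (x.map Q).map e := by
      ext i j
      exact h (x i j)
    rw [← he, hP.2, hPQ, ← Matrix.map_sub _ (map_sub e), he.colNorm_map]

end CompleteIsometry

section Annihilators

lemma exists_dual_eq_zero_ne_zero {E : Type*} [AddCommGroup E] [TopologicalSpace E] [Module ℝ E]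
    [Module ℂ E] [IsScalarTower ℝ ℂ E] [IsTopologicalAddGroup E] [ContinuousSMul ℂ E]
    [LocallyConvexSpace ℝ E] {S : Submodule ℂ E} (hS : IsClosed (S : Set E)) {x : E}
    (hx : x ∉ S) : ∃ f : StrongDual ℂ E, (∀ s ∈ S, f s = 0) ∧ f x ≠ 0 := by
  obtain ⟨f, u, hf, hu⟩ := RCLike.geometric_hahn_banach_closed_point (𝕜 := ℂ)
    (S.restrictScalars ℝ).convex hS hx
  have hu0 : 0 < u := by simpa using hf 0 S.zero_mem
  refine ⟨f, fun s hs => ?_, fun hfx => ?_⟩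
  · by_contra hfs
    have h := hf (((u : ℂ) / f s) • s) (S.smul_mem _ hs)
    rw [map_smul, smul_eq_mul, div_mul_cancel₀ _ hfs] at h
    exact lt_irrefl u h
  · rw [hfx, map_zero] at hu
    exact hu0.asymm hu

lemma mem_of_isClosed_weakDual {Y : Type*} [NormedAddCommGroup Y] [NormedSpace ℂ Y]
    {S : Submodule ℂ (WeakDual ℂ Y)} (hS : IsClosed (S : Set (WeakDual ℂ Y)))
    {f : WeakDual ℂ Y} (hf : ∀ y : Y, (∀ g ∈ S, g y = 0) → f y = 0) : f ∈ S := by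
  by_contra hfS
  obtain ⟨φ, hφ, hφf⟩ :=
    exists_dual_eq_zero_ne_zero (E := WeakBilin (topDualPairing ℂ Y)) (S := S) hS hfS
  obtain ⟨y, rfl⟩ := LinearMap.dualEmbedding_surjective (topDualPairing ℂ Y) φ
  exact hφf (hf y hφ)

variable {E : Type*} [NormedAddCommGroup E] [NormedSpace ℂ E] {J : Submodule ℂ E}

/-- The second annihilator `J^⊥⊥` in the bidual. -/
abbrev biannihilator (J : Submodule ℂ E) : Submodule ℂ (StrongDual ℂ (StrongDual ℂ E)) :=
  StrongDual.polarSubmodule ℂ (StrongDual.polarSubmodule ℂ J)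

lemma inclusionInDoubleDual_mem_biannihilator {x : E} (hx : x ∈ J) :
    NormedSpace.inclusionInDoubleDual ℂ E x ∈ biannihilator J :=
  (StrongDual.mem_polarSubmodule ℂ _ _).mpr fun _ hf =>
    (StrongDual.mem_polarSubmodule ℂ _ _).mp hf x hx

end Annihilators

section Adjoint

variable {E F : Type*} [NormedAddCommGroup E] [NormedSpace ℂ E] [NormedAddCommGroup F]
  [NormedSpace ℂ F]

/-- The Banach space adjoint of a bounded operator. -/
def dualMap (T : E →L[ℂ] F) : StrongDual ℂ F →L[ℂ] StrongDual ℂ E :=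
  ContinuousLinearMap.precomp ℂ T

lemma ker_dualMap (T : E →L[ℂ] F) :
    (dualMap T).toLinearMap.ker = StrongDual.polarSubmodule ℂ T.toLinearMap.range := by
  ext f
  rw [StrongDual.mem_polarSubmodule, LinearMap.mem_ker]
  refine ContinuousLinearMap.ext_iff.trans ⟨?_, fun h x => h _ ⟨x, rfl⟩⟩
  rintro h _ ⟨x, rfl⟩
  exact h x

lemma dualMap_injective : Function.Injective (dualMap : (E →L[ℂ] F) → _) := fun _ _ h =>
  ContinuousLinearMap.ext fun x => (SeparatingDual.eq_iff_forall_dual_eq (R := ℂ)).mpr fun f =>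
    DFunLike.congr_fun (DFunLike.congr_fun h f) x

variable {T : E →L[ℂ] E}

lemma range_dualMap (hT : T.toLinearMap ∘ₗ T.toLinearMap = T.toLinearMap) :
    (dualMap T).toLinearMap.range = StrongDual.polarSubmodule ℂ T.toLinearMap.ker := by
  ext f
  rw [StrongDual.mem_polarSubmodule]
  constructor
  · rintro ⟨g, rfl⟩ x hx
    exact (congrArg g hx).trans (map_zero g)
  · refine fun hf => ⟨f, ContinuousLinearMap.ext fun x => (sub_eq_zero.mp ?_).symm⟩
    rw [LinearMap.IsIdempotentElem.ker_eq_range hT] at hf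
    exact (map_sub f x (T x)).symm.trans (hf _ ⟨x, rfl⟩)

lemma dualMap_comp_self_iff :
    (dualMap T).toLinearMap ∘ₗ (dualMap T).toLinearMap = (dualMap T).toLinearMap ↔
      T.toLinearMap ∘ₗ T.toLinearMap = T.toLinearMap := by
  have comp : (dualMap T).toLinearMap ∘ₗ (dualMap T).toLinearMap =
      (dualMap (T.comp T)).toLinearMap := rfl
  rw [comp, ContinuousLinearMap.coe_inj, dualMap_injective.eq_iff, ← ContinuousLinearMap.coe_inj,
    ContinuousLinearMap.toLinearMap_comp]

namespace IsContractiveProjection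

/-- A contractive projection as a bounded operator. -/
def toCLM {Q : E →ₗ[ℂ] E} (hQ : IsContractiveProjection Q) : E →L[ℂ] E :=
  Q.mkContinuous 1 fun x => (one_mul ‖x‖).symm ▸ hQ.2 x

protected lemma dualMap (hT : IsContractiveProjection T.toLinearMap) :
    IsContractiveProjection (dualMap T).toLinearMap := by
  refine ⟨dualMap_comp_self_iff.mpr hT.1, fun f => ?_⟩
  refine ContinuousLinearMap.opNorm_le_bound _ (norm_nonneg f) fun x => ?_
  exact f.le_opNorm_of_le (hT.2 x)

end IsContractiveProjection

end Adjoint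

section BidualRetraction

variable {E Z : Type*} [NormedAddCommGroup E] [NormedSpace ℂ E] [NormedAddCommGroup Z]
  [NormedSpace ℂ Z] (e : E ≃ₗᵢ[ℂ] StrongDual ℂ Z)

/-- The elements of the predual `Z` of `E` as functionals on `E`. -/
def predualEmbedding : Z →ₗᵢ[ℂ] StrongDual ℂ E where
  toLinearMap := (e.toContinuousLinearEquiv : E →L[ℂ] StrongDual ℂ Z).flip.toLinearMap
  norm_map' z :=
    (ContinuousLinearMap.opNorm_comp_linearIsometryEquiv
      (NormedSpace.inclusionInDoubleDual ℂ Z z) e).trans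
      ((NormedSpace.inclusionInDoubleDualLi ℂ).norm_map z)

/-- The restriction `E** = Z*** → Z* = E` of functionals on `Z**` to `Z`. -/
def bidualRetraction : StrongDual ℂ (StrongDual ℂ E) →ₗ[ℂ] E :=
  e.symm.toLinearEquiv.toLinearMap ∘ₗ
    (dualMap (predualEmbedding e).toContinuousLinearMap).toLinearMap

lemma apply_bidualRetraction (F : StrongDual ℂ (StrongDual ℂ E)) (z : Z) :
    e (bidualRetraction e F) z = F (predualEmbedding e z) :=
  DFunLike.congr_fun
    (e.apply_symm_apply (dualMap (predualEmbedding e).toContinuousLinearMap F)) z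

lemma bidualRetraction_inclusionInDoubleDual (x : E) :
    bidualRetraction e (NormedSpace.inclusionInDoubleDual ℂ E x) = x :=
  e.symm_apply_apply x

lemma norm_bidualRetraction_le (F : StrongDual ℂ (StrongDual ℂ E)) :
    ‖bidualRetraction e F‖ ≤ ‖F‖ := by
  rw [← e.norm_map]
  refine ContinuousLinearMap.opNorm_le_bound _ (norm_nonneg F) fun z => ?_
  rw [apply_bidualRetraction, ← (predualEmbedding e).norm_map z]
  exact F.le_opNorm _

lemma bidualRetraction_eq_zero_iff {F : StrongDual ℂ (StrongDual ℂ E)} :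
    bidualRetraction e F = 0 ↔ ∀ z, F (predualEmbedding e z) = 0 := by
  rw [← e.map_eq_zero_iff, ContinuousLinearMap.ext_iff]
  simp only [apply_bidualRetraction, _root_.zero_apply]

lemma bidualRetraction_mem {J : Submodule ℂ E}
    (hJ : IsClosed ((fun x => StrongDual.toWeakDual (e x)) '' (J : Set E)))
    {F : StrongDual ℂ (StrongDual ℂ E)}
    (hF : F ∈ biannihilator J) :
    bidualRetraction e F ∈ J := by
  let φ : E ≃ₗ[ℂ] WeakDual ℂ Z := e.toLinearEquiv.trans StrongDual.toWeakDual
  suffices h : φ (bidualRetraction e F) ∈ J.map φ.toLinearMap from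
    φ.injective.mem_set_image.mp h
  refine mem_of_isClosed_weakDual hJ fun z hz => ?_
  refine (apply_bidualRetraction e F z).trans ((StrongDual.mem_polarSubmodule ℂ _ _).mp hF _ ?_)
  exact (StrongDual.mem_polarSubmodule ℂ _ _).mpr fun j hj => hz _ ⟨j, hj, rfl⟩

lemma bidualRetraction_apply_eq_zero {J : Submodule ℂ E}
    (hJ : IsClosed ((fun x => StrongDual.toWeakDual (e x)) '' (J : Set E)))
    {P : StrongDual ℂ (StrongDual ℂ E) →ₗ[ℂ] StrongDual ℂ (StrongDual ℂ E)}
    (hPP : P ∘ₗ P = P) (hP : IsPythagorean (E := StrongDual ℂ (StrongDual ℂ E)) P)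
    (hPJ : P.range = biannihilator J)
    {F : StrongDual ℂ (StrongDual ℂ E)} (hF : bidualRetraction e F = 0) :
    bidualRetraction e (P F) = 0 := by
  set x := bidualRetraction e (P F)
  set y := NormedSpace.inclusionInDoubleDual ℂ E (-x)
  have x_mem : x ∈ J := bidualRetraction_mem e hJ (hPJ.le ⟨F, rfl⟩)
  have hPy : P y = y :=
    (LinearMap.IsIdempotentElem.mem_range_iff hPP).mp
      (hPJ.ge (inclusionInDoubleDual_mem_biannihilator (J.neg_mem x_mem)))
  have hTy : bidualRetraction e y = -x := bidualRetraction_inclusionInDoubleDual e (-x)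
  have hT : bidualRetraction e (F - P F) = -x :=
    (LinearMap.map_sub (bidualRetraction e) F (P F)).trans (by rw [hF, zero_sub])
  have y_norm : ‖y‖ ≤ ‖bidualRetraction e y‖ :=
    hTy ▸ NormedSpace.double_dual_bound ℂ E (-x)
  have hTF := hP.apply_sub_eq_zero (norm_bidualRetraction_le e) hPy (hTy.trans hT.symm) y_norm
  exact neg_eq_zero.mp (hT.symm.trans hTF)

lemma exists_dualMap_apply_predualEmbedding [CompleteSpace Z] {T : E →L[ℂ] E}
    (hT : ∀ F, bidualRetraction e F = 0 → bidualRetraction e (dualMap (dualMap T) F) = 0) :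
    ∃ R : Z →L[ℂ] Z, ∀ x z, e (T x) z = e x (R z) := by
  set ι := predualEmbedding e
  have mem_range (z : Z) : dualMap T (ι z) ∈ ι.toLinearMap.range := by
    by_contra h
    have closed : IsClosed (ι.toLinearMap.range : Set (StrongDual ℂ E)) :=
      ι.isometry.isClosedEmbedding.isClosed_range
    obtain ⟨F, hF, hFz⟩ := exists_dual_eq_zero_ne_zero closed h
    have hF0 := hT F ((bidualRetraction_eq_zero_iff e).mpr fun w => hF _ ⟨w, rfl⟩)
    exact hFz ((bidualRetraction_eq_zero_iff e).mp hF0 z)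
  let R : Z →L[ℂ] Z := (ι.equivRange.symm.toContinuousLinearEquiv : _ →L[ℂ] Z).comp
    (((dualMap T).comp ι.toContinuousLinearMap).codRestrict _ mem_range)
  refine ⟨R, fun x z => ?_⟩
  have hR : ι (R z) = dualMap T (ι z) := congrArg Subtype.val (ι.equivRange.apply_symm_apply _)
  exact (DFunLike.congr_fun hR x).symm

end BidualRetraction

section IsometricEmbedding

variable {E V : Type*} [NormedAddCommGroup E] [NormedSpace ℂ E] [NormedAddCommGroup V]
  [NormedSpace ℂ V]

lemma exists_dualMap_eq_norm_eq (i : V →ₗᵢ[ℂ] E) (g : StrongDual ℂ V) :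
    ∃ f : StrongDual ℂ E, dualMap i.toContinuousLinearMap f = g ∧ ‖f‖ = ‖g‖ := by
  obtain ⟨f, hf, hf_norm⟩ := exists_extension_norm_eq i.toLinearMap.range
    (g.comp (i.equivRange.symm.toContinuousLinearEquiv : _ →L[ℂ] V))
  refine ⟨f, ContinuousLinearMap.ext fun v => ?_, hf_norm.trans ?_⟩
  · exact (hf (i.equivRange v)).trans (congrArg g (i.equivRange.symm_apply_apply v))
  · exact g.opNorm_comp_linearIsometryEquiv i.equivRange.symm

lemma exists_linearMap_biannihilator_bidual (i : V →ₗᵢ[ℂ] E) {J : Submodule ℂ E}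
    (hJ : i.toLinearMap.range = J) :
    ∃ L : biannihilator J →ₗ[ℂ] StrongDual ℂ (StrongDual ℂ V),
      (∀ F f, L F (dualMap i.toContinuousLinearMap f) = F.1 f) ∧ ∀ F, ‖L F‖ ≤ ‖F.1‖ := by
  let r := dualMap i.toContinuousLinearMap
  obtain ⟨s, hs⟩ := r.toLinearMap.exists_rightInverse_of_surjective
    (LinearMap.range_eq_top.mpr fun g => (exists_dualMap_eq_norm_eq i g).imp fun _ h => h.1)
  have apply_eq (F : biannihilator J) (f : StrongDual ℂ E) : F.1 (s (r f)) = F.1 f := by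
    rw [← sub_eq_zero, ← map_sub]
    refine (StrongDual.mem_polarSubmodule ℂ _ _).mp F.2 _ ?_
    rw [← hJ]
    refine (ker_dualMap i.toContinuousLinearMap).le ?_
    rw [LinearMap.mem_ker, map_sub, sub_eq_zero]
    exact LinearMap.congr_fun hs (r f)
  have bound (F : biannihilator J) (g : StrongDual ℂ V) : ‖F.1 (s g)‖ ≤ ‖F.1‖ * ‖g‖ := by
    obtain ⟨f, rfl, hf⟩ := exists_dualMap_eq_norm_eq i g
    rw [apply_eq, ← hf]
    exact F.1.le_opNorm f
  let L : biannihilator J →ₗ[ℂ] StrongDual ℂ (StrongDual ℂ V) :=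
    { toFun F := (F.1.toLinearMap ∘ₗ s).mkContinuous ‖F.1‖ (bound F)
      map_add' _ _ := rfl
      map_smul' _ _ := rfl }
  exact ⟨L, apply_eq, fun F => LinearMap.mkContinuous_norm_le _ (norm_nonneg F.1) (bound F)⟩

end IsometricEmbedding

section Ideal

variable {X : Type*} [NormedAddCommGroup X] [NormedSpace ℂ X]

lemma IsContractiveProjection.exists_of_bidual {J : Submodule ℂ X}
    {P : StrongDual ℂ (StrongDual ℂ X) →ₗ[ℂ] StrongDual ℂ (StrongDual ℂ X)}
    (hP : IsContractiveProjection (E := StrongDual ℂ (StrongDual ℂ X)) P)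
    (hPJ : P.range = biannihilator J)
    (ρ : biannihilator J →ₗ[ℂ] X)
    (hρ_mem : ∀ F, ρ F ∈ J) (hρ_norm : ∀ F, ‖ρ F‖ ≤ ‖F.1‖)
    (hρ_incl : ∀ F, ∀ x ∈ J, F.1 = NormedSpace.inclusionInDoubleDual ℂ X x → ρ F = x) :
    ∃ Q : X →ₗ[ℂ] X, IsContractiveProjection Q ∧ Q.range = J := by
  let ι := NormedSpace.inclusionInDoubleDual ℂ X
  let Q : X →ₗ[ℂ] X := ρ ∘ₗ (P ∘ₗ ι.toLinearMap).codRestrict _ fun x => hPJ ▸ ⟨ι x, rfl⟩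
  have Q_mem (x : X) : Q x ∈ J := hρ_mem _
  have Q_fixes {x : X} (hx : x ∈ J) : Q x = x := by
    refine hρ_incl _ x hx ((LinearMap.IsIdempotentElem.mem_range_iff hP.1).mp ?_)
    exact hPJ ▸ inclusionInDoubleDual_mem_biannihilator hx
  refine ⟨Q, ⟨LinearMap.ext fun x => Q_fixes (Q_mem x), fun x => ?_⟩, le_antisymm ?_ ?_⟩
  · exact (hρ_norm _).trans ((hP.2 _).trans (NormedSpace.double_dual_bound ℂ X x))
  · rintro _ ⟨x, rfl⟩
    exact Q_mem x
  · exact fun x hx => ⟨x, Q_fixes hx⟩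

variable [OperatorSpace X] {J : Submodule ℂ X}

lemma IsCompleteLeftMProjection.eq_dualMap_dualMap
    {P : StrongDual ℂ (StrongDual ℂ X) →ₗ[ℂ] StrongDual ℂ (StrongDual ℂ X)}
    (hP : IsCompleteLeftMProjection (X := StrongDual ℂ (StrongDual ℂ X)) P)
    (hPJ : P.range = biannihilator J) {Q : X →ₗ[ℂ] X} (hQ : IsContractiveProjection Q)
    (hQJ : Q.range = J) :
    P = (dualMap (dualMap hQ.toCLM)).toLinearMap := by
  have hQ' : IsContractiveProjection hQ.toCLM.toLinearMap := hQ
  refine hP.eq_of_range_eq hQ'.dualMap.dualMap ?_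
  rw [range_dualMap hQ'.dualMap.1, ker_dualMap, hPJ, ← hQJ]
  rfl

namespace IsCompleteRightMIdeal

theorem isCompleteLeftMProjection (hJ : IsCompleteRightMIdeal J) {Q : X →ₗ[ℂ] X}
    (hQ : IsContractiveProjection Q) (hQJ : Q.range = J) : IsCompleteLeftMProjection Q := by
  obtain ⟨-, P, hP, hPJ⟩ := hJ
  refine hP.of_isCompleteIsometry (isCompleteIsometry_inclusionInDoubleDual X) fun x => ?_
  rw [IsCompleteLeftMProjection.eq_dualMap_dualMap hP hPJ hQ hQJ]
  rfl

theorem isCompleteRightMSummand_of_linearIsometryEquiv (hJ : IsCompleteRightMIdeal J) {Z : Type*}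
    [NormedAddCommGroup Z] [NormedSpace ℂ Z] (e : J ≃ₗᵢ[ℂ] StrongDual ℂ Z) :
    IsCompleteRightMSummand J := by
  obtain ⟨P, hP, hPJ⟩ := hJ.2
  obtain ⟨L, hL, hL_norm⟩ :=
    exists_linearMap_biannihilator_bidual J.subtypeₗᵢ (J := J) J.range_subtype
  obtain ⟨Q, hQ, hQJ⟩ := IsContractiveProjection.exists_of_bidual
    hP.isContractiveProjection hPJ
    (J.subtype ∘ₗ bidualRetraction e ∘ₗ L) (fun F => Subtype.prop _)
    (fun F => (norm_bidualRetraction_le e _).trans (hL_norm F)) fun F x hx hF => by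
      suffices h : L F = NormedSpace.inclusionInDoubleDual ℂ J ⟨x, hx⟩ by
        rw [LinearMap.comp_apply, LinearMap.comp_apply, h,
          bidualRetraction_inclusionInDoubleDual, Submodule.subtype_apply]
      ext g
      obtain ⟨f, rfl, -⟩ := exists_dualMap_eq_norm_eq J.subtypeₗᵢ g
      rw [hL, hF]
      rfl
  exact ⟨Q, hJ.isCompleteLeftMProjection hQ hQJ, hQJ⟩

theorem exists_preadjoint (hJ : IsCompleteRightMIdeal J) {Y : Type*} [NormedAddCommGroup Y]
    [NormedSpace ℂ Y] [CompleteSpace Y] (e : X ≃ₗᵢ[ℂ] StrongDual ℂ Y)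
    (hJ_closed : IsClosed ((fun x => StrongDual.toWeakDual (e x)) '' (J : Set X))) :
    ∃ (Q : X →ₗ[ℂ] X) (R : Y →L[ℂ] Y), IsCompleteLeftMProjection Q ∧ Q.range = J ∧
      ∀ x y, e (Q x) y = e x (R y) := by
  obtain ⟨P, hP, hPJ⟩ := hJ.2
  obtain ⟨Q, hQ, hQJ⟩ := IsContractiveProjection.exists_of_bidual
    hP.isContractiveProjection hPJ (bidualRetraction e ∘ₗ (biannihilator J).subtype)
    (fun F => bidualRetraction_mem e hJ_closed F.2) (fun F => norm_bidualRetraction_le e F.1)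
    fun F x _ hF => (congrArg _ hF).trans (bidualRetraction_inclusionInDoubleDual e x)
  have hPQ := IsCompleteLeftMProjection.eq_dualMap_dualMap hP hPJ hQ hQJ
  obtain ⟨R, hR⟩ := exists_dualMap_apply_predualEmbedding e (T := hQ.toCLM) fun F hF =>
    (congrArg _ (LinearMap.congr_fun hPQ F).symm).trans
      (bidualRetraction_apply_eq_zero e hJ_closed hP.1 hP.isPythagorean hPJ hF)
  exact ⟨Q, R, hJ.isCompleteLeftMProjection hQ hQJ, hQJ, hR⟩

end IsCompleteRightMIdeal

end Ideal

section ScalarRowsAndColumns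

variable {a b c d : Type*} [Fintype a] [Fintype b] [Fintype c] [Fintype d]

lemma l2_fromCols_zero [DecidableEq b] [DecidableEq c] (A : Matrix a b ℂ) :
    ‖fromCols A (0 : Matrix a c ℂ)‖ = ‖A‖ := by
  classical
  refine le_antisymm ((sq_le_sq₀ (norm_nonneg _) (norm_nonneg A)).mp ?_) ?_
  · exact (l2_fromCols_sq_le A 0).trans_eq (by rw [norm_zero, zero_pow two_ne_zero, add_zero])
  · exact l2_submatrix_le (fromCols A (0 : Matrix a c ℂ)) id Sum.inl Function.injective_id
      Sum.inl_injective

/- `v₀ ⊗ A + v₁ ⊗ B = ([v₀ v₁] ⊗ 1) (1 ⊗ [A; B])`. -/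
lemma l2_kronecker_add_kronecker_le [DecidableEq b] [DecidableEq d] (v₀ v₁ : Matrix a b ℂ)
    (A B : Matrix c d ℂ) : ‖v₀ ⊗ₖ A + v₁ ⊗ₖ B‖ ≤ ‖fromCols v₀ v₁‖ * ‖fromRows A B‖ := by
  classical
  have row : fromCols (v₀ ⊗ₖ (1 : Matrix c c ℂ)) (v₁ ⊗ₖ (1 : Matrix c c ℂ)) =
      (fromCols v₀ v₁ ⊗ₖ (1 : Matrix c c ℂ)).submatrix id (Equiv.sumProdDistrib b b c).symm := by
    ext i (j | j) <;> rfl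
  have column : fromRows ((1 : Matrix b b ℂ) ⊗ₖ A) ((1 : Matrix b b ℂ) ⊗ₖ B) =
      ((1 : Matrix b b ℂ) ⊗ₖ fromRows A B).submatrix (Equiv.prodSumDistrib b c c).symm id := by
    ext (i | i) j <;> rfl
  have factor : v₀ ⊗ₖ A + v₁ ⊗ₖ B = fromCols (v₀ ⊗ₖ (1 : Matrix c c ℂ)) (v₁ ⊗ₖ (1 : Matrix c c ℂ)) *
      fromRows ((1 : Matrix b b ℂ) ⊗ₖ A) ((1 : Matrix b b ℂ) ⊗ₖ B) := by
    simp only [fromCols_mul_fromRows, ← mul_kronecker_mul, Matrix.mul_one, Matrix.one_mul]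
  rw [factor, row, column]
  refine (l2_opNorm_mul _ _).trans (mul_le_mul ?_ ?_ (norm_nonneg _) (norm_nonneg _))
  · exact (l2_submatrix_le _ _ _ Function.injective_id (Equiv.injective _)).trans
      (l2_kronecker_one_le _)
  · refine (l2_submatrix_le _ _ _ (Equiv.injective _) Function.injective_id).trans
      ((l2_kronecker_le _ _).trans (mul_le_of_le_one_left (norm_nonneg _) l2_one_le))

variable {p : ℕ}

lemma rowScalarNorm_eq (v : Fin 2 → Matrix (Fin p) (Fin p) ℂ) :
    rowScalarNorm v = ‖fromCols (v 0) (v 1)‖ := by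
  rw [rowScalarNorm, ← l2_submatrix_equiv _ (Equiv.refl _) ((Equiv.boolProdEquivSum _).symm.trans
    (finTwoEquiv.symm.prodCongr (Equiv.refl _)))]
  congr 1
  ext i (j | j) <;> rfl

lemma rowScalarNorm_smul (s : ℂ) (v : Fin 2 → Matrix (Fin p) (Fin p) ℂ) :
    rowScalarNorm (s • v) = ‖s‖ * rowScalarNorm v := by
  rw [rowScalarNorm, rowScalarNorm, ← norm_smul]
  rfl

lemma rowScalarNorm_matBlocks_le {p' : ℕ} (v : Fin 2 → Matrix (Fin p) (Fin p) ℂ)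
    (v' : Fin 2 → Matrix (Fin p') (Fin p') ℂ) :
    rowScalarNorm (fun k => matBlocks (v k) 0 0 (v' k)) ≤
      max (rowScalarNorm v) (rowScalarNorm v') := by
  simp only [rowScalarNorm_eq]
  refine le_trans (le_of_eq_of_le ?_ (l2_submatrix_le
    (fromBlocks (fromCols (v 0) (v 1)) 0 0 (fromCols (v' 0) (v' 1)))
    finSumFinEquiv.symm
    (Equiv.sumSumSumComm _ _ _ _ ∘ Sum.map finSumFinEquiv.symm finSumFinEquiv.symm)
    (Equiv.injective _) ((Equiv.injective _).comp
      ((Equiv.injective _).sumMap (Equiv.injective _))))) (l2_fromBlocks_diagonal_le _ _)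
  congr 1
  ext i (j | j) <;> obtain ⟨i | i, rfl⟩ := finSumFinEquiv.surjective i <;>
    obtain ⟨j | j, rfl⟩ := finSumFinEquiv.surjective j <;>
    simp [matBlocks]

end ScalarRowsAndColumns

section Columns

variable {V F : Type*} [FunLike F V ℂ] [Zero F] {c d : Type*}
  [Fintype c] [Fintype d] [DecidableEq d] {n : ℕ}

lemma norm_matEval_column (h₀ : ∀ v, (0 : F) v = 0) (f g : Matrix (Fin n) (Fin n) F)
    (w : Matrix c d V) :
    ‖matEval (matBlocks f 0 g 0) w‖ = ‖fromRows (matEval f w) (matEval g w)‖ := by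
  have e : matEval (matBlocks f 0 g 0) w =
      (fromCols (fromRows (matEval f w) (matEval g w)) (0 : Matrix _ (Fin n × d) ℂ)).submatrix
        ((finSumFinEquiv.symm.prodCongr (Equiv.refl c)).trans (Equiv.sumProdDistrib _ _ _))
        ((finSumFinEquiv.symm.prodCongr (Equiv.refl d)).trans (Equiv.sumProdDistrib _ _ _)) := by
    ext ⟨i, k⟩ ⟨j, l⟩
    obtain ⟨i | i, rfl⟩ := finSumFinEquiv.surjective i <;>
      obtain ⟨j | j, rfl⟩ := finSumFinEquiv.surjective j <;>
      simp [matEval, matBlocks, h₀, -finSumFinEquiv_apply_left, -finSumFinEquiv_apply_right]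
  rw [e, l2_submatrix_equiv, l2_fromCols_zero]

end Columns

section RowTensor

variable {V : Type*} {a b c d : Type*}

/-- The element `[x y]` of `M_n(R_2[V])`, encoded as a matrix over `V × V`. -/
def rowMatrix (x y : Matrix a b V) : Matrix a b (V × V) :=
  of fun i j => (x i j, y i j)

lemma rowMatrix_inj {x y x' y' : Matrix a b V} :
    rowMatrix x y = rowMatrix x' y' ↔ x = x' ∧ y = y' := by
  simp only [← Matrix.ext_iff, rowMatrix, of_apply, Prod.mk.injEq, forall_and]

variable [AddCommGroup V] [Module ℂ V]

/-- The tensor product `v ⊗ w` of a matrix `[v₀ v₁]` over the row space `R_2` and a matrix `w`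
over `V`, as a matrix over `R_2[V]`. -/
def rowTensor (v : Fin 2 → Matrix a b ℂ) (w : Matrix c d V) : Matrix (a × c) (b × d) (V × V) :=
  rowMatrix (kroneckerMap (· • ·) (v 0) w) (kroneckerMap (· • ·) (v 1) w)

lemma rowTensor_smul_smul (s t : ℂ) (v : Fin 2 → Matrix a b ℂ) (w : Matrix c d V) :
    rowTensor (s • v) (t • w) = (s * t) • rowTensor v w := by
  ext i j <;> simp [rowTensor, rowMatrix, smul_smul, mul_right_comm, mul_assoc]

lemma matSandwich_rowMatrix [Fintype b] [Fintype c] (α : Matrix a b ℂ) (x y : Matrix b c V)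
    (β : Matrix c d ℂ) :
    matSandwich α (rowMatrix x y) β = rowMatrix (matSandwich α x β) (matSandwich α y β) := by
  ext i j <;> simp [matSandwich, rowMatrix, Prod.fst_sum, Prod.snd_sum]

lemma rowMatrix_eq_matSandwich_rowTensor_iff {n p q : ℕ} {x y : Matrix (Fin n) (Fin n) V}
    {α : Matrix (Fin n) (Fin p × Fin q) ℂ} {v : Fin 2 → Matrix (Fin p) (Fin p) ℂ}
    {w : Matrix (Fin q) (Fin q) V} {β : Matrix (Fin p × Fin q) (Fin n) ℂ} :
    rowMatrix x y = matSandwich α (rowTensor v w) β ↔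
      x = matSandwich α (of fun a b => v 0 a.1 b.1 • w a.2 b.2) β ∧
        y = matSandwich α (of fun a b => v 1 a.1 b.1 • w a.2 b.2) β := by
  rw [rowTensor, matSandwich_rowMatrix, rowMatrix_inj]
  rfl

lemma exists_eq_matSandwich_rowTensor {n : ℕ} (u : Matrix (Fin n) (Fin n) (V × V)) :
    ∃ (p q : ℕ) (α : Matrix (Fin n) (Fin p × Fin q) ℂ) (v : Fin 2 → Matrix (Fin p) (Fin p) ℂ)
      (w : Matrix (Fin q) (Fin q) V) (β : Matrix (Fin p × Fin q) (Fin n) ℂ),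
      u = matSandwich α (rowTensor v w) β := by
  refine ⟨2, n + n,
    of fun i a => if a.2 = ![Fin.castAdd n i, Fin.natAdd n i] a.1 then 1 else 0,
    fun s => single s s 1, matBlocks (u.map Prod.fst) 0 0 (u.map Prod.snd),
    of fun a i => if a.2 = ![Fin.castAdd n i, Fin.natAdd n i] a.1 then 1 else 0,
    (rowMatrix_eq_matSandwich_rowTensor_iff (x := u.map Prod.fst) (y := u.map Prod.snd)).mpr
      ⟨?_, ?_⟩⟩ <;>
  · ext i j
    simp [matSandwich, Fintype.sum_prod_type, single_apply, matBlocks, -Fin.natAdd_eq_addNat]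

lemma matEval_kroneckerMap_smul {F : Type*} [FunLike F V ℂ] [LinearMapClass F ℂ V ℂ]
    {r s : Type*} (f : Matrix r s F) (v : Matrix a b ℂ) (w : Matrix c d V) :
    matEval f (kroneckerMap (· • ·) v w) =
      (v ⊗ₖ matEval f w).submatrix (fun i => (i.2.1, i.1, i.2.2))
        (fun j => (j.2.1, j.1, j.2.2)) := by
  ext i j
  exact map_smul (f i.1 j.1) (v i.2.1 j.2.1) (w i.2.2 j.2.2)

end RowTensor

section ProjectiveNorm

variable {X : Type*} [NormedAddCommGroup X] [NormedSpace ℂ X] [OperatorSpace X] {m n : ℕ}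
  {x y : Matrix (Fin n) (Fin n) X}

lemma norm_mul_rowScalarNorm_mul_matNorm_mul_norm_nonneg {a b c d : Type*} [Fintype a] [Fintype b]
    [Fintype c] [Fintype d] [DecidableEq b] [DecidableEq d] {p q : ℕ} (α : Matrix a b ℂ)
    (v : Fin 2 → Matrix (Fin p) (Fin p) ℂ) (w : Matrix (Fin q) (Fin q) X) (β : Matrix c d ℂ) :
    0 ≤ ‖α‖ * rowScalarNorm v * matNorm q w * ‖β‖ :=
  mul_nonneg (mul_nonneg (mul_nonneg (norm_nonneg _) (norm_nonneg _)) (apply_nonneg _ _))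
    (norm_nonneg _)

lemma rowProjNorm_nonneg (x y : Matrix (Fin n) (Fin n) X) : 0 ≤ rowProjNorm x y := by
  refine Real.sInf_nonneg ?_
  rintro r ⟨p, q, α, v, w, β, -, -, rfl⟩
  exact norm_mul_rowScalarNorm_mul_matNorm_mul_norm_nonneg α v w β

lemma rowProjNorm_le {p q : ℕ} {α : Matrix (Fin n) (Fin p × Fin q) ℂ}
    {v : Fin 2 → Matrix (Fin p) (Fin p) ℂ} {w : Matrix (Fin q) (Fin q) X}
    {β : Matrix (Fin p × Fin q) (Fin n) ℂ}
    (h : rowMatrix x y = matSandwich α (rowTensor v w) β) :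
    rowProjNorm x y ≤ ‖α‖ * rowScalarNorm v * matNorm q w * ‖β‖ := by
  obtain ⟨hx, hy⟩ := rowMatrix_eq_matSandwich_rowTensor_iff.mp h
  refine csInf_le ⟨0, ?_⟩ ⟨p, q, α, v, w, β, hx, hy, rfl⟩
  rintro r ⟨p, q, α, v, w, β, -, -, rfl⟩
  exact norm_mul_rowScalarNorm_mul_matNorm_mul_norm_nonneg α v w β

lemma exists_of_rowProjNorm_lt {r : ℝ} (h : rowProjNorm x y < r) :
    ∃ (p q : ℕ) (α : Matrix (Fin n) (Fin p × Fin q) ℂ) (v : Fin 2 → Matrix (Fin p) (Fin p) ℂ)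
      (w : Matrix (Fin q) (Fin q) X) (β : Matrix (Fin p × Fin q) (Fin n) ℂ),
      rowMatrix x y = matSandwich α (rowTensor v w) β ∧
        ‖α‖ * rowScalarNorm v * matNorm q w * ‖β‖ < r := by
  obtain ⟨p, q, α, v, w, β, huv⟩ := exists_eq_matSandwich_rowTensor (rowMatrix x y)
  obtain ⟨hx, hy⟩ := rowMatrix_eq_matSandwich_rowTensor_iff.mp huv
  obtain ⟨_, ⟨p, q, α, v, w, β, hx, hy, rfl⟩, hr⟩ :=
    exists_lt_of_csInf_lt (by exact ⟨_, p, q, α, v, w, β, hx, hy, rfl⟩) h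
  exact ⟨p, q, α, v, w, β, rowMatrix_eq_matSandwich_rowTensor_iff.mpr ⟨hx, hy⟩, hr⟩

lemma norm_fromRows_matPairing_le (f g : Matrix (Fin m) (Fin m) (StrongDual ℂ X))
    (x : Matrix (Fin n) (Fin n) X) :
    ‖fromRows (matEval f x) (matEval g x)‖ ≤ colNorm f g * matNorm n x :=
  (norm_matEval_column (fun _ => rfl) f g x).symm.trans_le (norm_matPairing_le _ x)

lemma norm_matEval_rowTensor_le {V : Type*} [AddCommGroup V] [Module ℂ V] {F : Type*}
    [FunLike F V ℂ] [LinearMapClass F ℂ V ℂ] {p q : ℕ} (f g : Matrix (Fin m) (Fin m) F)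
    (v : Fin 2 → Matrix (Fin p) (Fin p) ℂ) (w : Matrix (Fin q) (Fin q) V) :
    ‖matEval f (kroneckerMap (· • ·) (v 0) w) + matEval g (kroneckerMap (· • ·) (v 1) w)‖ ≤
      rowScalarNorm v * ‖fromRows (matEval f w) (matEval g w)‖ := by
  rw [matEval_kroneckerMap_smul, matEval_kroneckerMap_smul, rowScalarNorm_eq]
  refine (l2_submatrix_le (v 0 ⊗ₖ matEval f w + v 1 ⊗ₖ matEval g w) _ _ ?_ ?_).trans
    (l2_kronecker_add_kronecker_le _ _ _ _) <;>
  · rintro ⟨i, j, k⟩ ⟨i', j', k'⟩ h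
    simp_all

lemma norm_matPairing_add_le (f g : Matrix (Fin m) (Fin m) (StrongDual ℂ X))
    (x y : Matrix (Fin n) (Fin n) X) :
    ‖matPairing f x + matPairing g y‖ ≤ colNorm f g * rowProjNorm x y := by
  have hc : 0 ≤ colNorm f g := apply_nonneg _ _
  refine le_mul_of_forall_lt₀ fun s hs r hr => ?_
  obtain ⟨p, q, α, v, w, β, h, hr⟩ := exists_of_rowProjNorm_lt hr
  obtain ⟨hx, hy⟩ := rowMatrix_eq_matSandwich_rowTensor_iff.mp h
  have hv : 0 ≤ rowScalarNorm v := norm_nonneg _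
  let one : Matrix (Fin m) (Fin m) ℂ := 1
  let A := matEval f (kroneckerMap (· • ·) (v 0) w) + matEval g (kroneckerMap (· • ·) (v 1) w)
  have factor : matPairing f x + matPairing g y = (one ⊗ₖ α) * A * (one ⊗ₖ β) := by
    rw [hx, hy, Matrix.mul_add, Matrix.add_mul]
    exact congrArg₂ _ (matEval_matSandwich f α _ β) (matEval_matSandwich g α _ β)
  calc ‖matPairing f x + matPairing g y‖
      ≤ ‖one ⊗ₖ α‖ * ‖A‖ * ‖one ⊗ₖ β‖ := by
        rw [factor]
        exact (l2_opNorm_mul _ _).trans (by gcongr; exact l2_opNorm_mul _ _)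
    _ ≤ (1 * ‖α‖) * (rowScalarNorm v * (colNorm f g * matNorm q w)) * (1 * ‖β‖) := by
        gcongr
        · exact (l2_kronecker_le _ _).trans (by gcongr; exact l2_one_le)
        · exact (norm_matEval_rowTensor_le f g v w).trans
            (by gcongr; exact norm_fromRows_matPairing_le f g w)
        · exact (l2_kronecker_le _ _).trans (by gcongr; exact l2_one_le)
    _ = colNorm f g * (‖α‖ * rowScalarNorm v * matNorm q w * ‖β‖) := by ring
    _ ≤ s * r :=
        mul_le_mul hs.le hr.le (norm_mul_rowScalarNorm_mul_matNorm_mul_norm_nonneg α v w β)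
          (hc.trans hs.le)

variable (X) in
/-- The elements of `M_m(R_2[X])` with a representation `α (v ⊗ w) β` by factors of norm at most
one: between the open and the closed unit ball of the projective norm. -/
def rowProjBall (m : ℕ) : Set (Matrix (Fin m) (Fin m) (X × X)) :=
  {u | ∃ (p q : ℕ) (α : Matrix (Fin m) (Fin p × Fin q) ℂ)
    (v : Fin 2 → Matrix (Fin p) (Fin p) ℂ) (w : Matrix (Fin q) (Fin q) X)
    (β : Matrix (Fin p × Fin q) (Fin m) ℂ),
    ‖α‖ ≤ 1 ∧ rowScalarNorm v ≤ 1 ∧ matNorm q w ≤ 1 ∧ ‖β‖ ≤ 1 ∧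
      u = matSandwich α (rowTensor v w) β}

lemma matBlocks_mem_rowProjBall {u : Matrix (Fin m) (Fin m) (X × X)}
    {u' : Matrix (Fin n) (Fin n) (X × X)} (hu : u ∈ rowProjBall X m) (hu' : u' ∈ rowProjBall X n) :
    matBlocks u 0 0 u' ∈ rowProjBall X (m + n) := by
  obtain ⟨p, q, α, v, w, β, hα, hv, hw, hβ, rfl⟩ := hu
  obtain ⟨p', q', α', v', w', β', hα', hv', hw', hβ', rfl⟩ := hu'
  let diag : (Fin p × Fin q) ⊕ (Fin p' × Fin q') → Fin (p + p') × Fin (q + q') :=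
    Sum.elim (Prod.map (Fin.castAdd p') (Fin.castAdd q')) (Prod.map (Fin.natAdd p) (Fin.natAdd q))
  have diag_injective : diag.Injective := by
    rintro (⟨a, b⟩ | ⟨a, b⟩) (⟨a', b'⟩ | ⟨a', b'⟩) h <;> simp [diag, Fin.ext_iff] at h ⊢ <;> omega
  let one : Matrix (Fin (p + p') × Fin (q + q')) (Fin (p + p') × Fin (q + q')) ℂ := 1
  let v'' (k : Fin 2) := matBlocks (v k) 0 0 (v' k)
  let A := (fromBlocks α 0 0 α').submatrix finSumFinEquiv.symm id
  let B := (fromBlocks β 0 0 β').submatrix id finSumFinEquiv.symm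
  have compression : (rowTensor v'' (matBlocks w 0 0 w')).submatrix diag diag =
      fromBlocks (rowTensor v w) 0 0 (rowTensor v' w') := by
    ext (⟨a, b⟩ | ⟨a, b⟩) (⟨a', b'⟩ | ⟨a', b'⟩) <;>
      simp [diag, rowTensor, rowMatrix, matBlocks, v'']
  refine ⟨p + p', q + q', A * one.submatrix diag id, v'', matBlocks w 0 0 w',
    one.submatrix id diag * B, ?_, (rowScalarNorm_matBlocks_le v v').trans (max_le hv hv'),
    (matNorm_directSum ..).trans_le (max_le hw hw'), ?_, ?_⟩
  · refine (l2_opNorm_mul _ _).trans (mul_le_one₀ ?_ (norm_nonneg _)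
      (l2_one_submatrix_le diag_injective Function.injective_id))
    exact (l2_submatrix_le _ _ _ finSumFinEquiv.symm.injective Function.injective_id).trans
      ((l2_fromBlocks_diagonal_le α α').trans (max_le hα hα'))
  · refine (l2_opNorm_mul _ _).trans (mul_le_one₀
      (l2_one_submatrix_le Function.injective_id diag_injective) (norm_nonneg _) ?_)
    exact (l2_submatrix_le _ _ _ Function.injective_id finSumFinEquiv.symm.injective).trans
      ((l2_fromBlocks_diagonal_le β β').trans (max_le hβ hβ'))
  · rw [← matSandwich_matSandwich, matSandwich_one_submatrix, compression, matBlocks,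
      ← matSandwich_fromBlocks_diagonal]
    rfl

lemma isMatrixConvex_rowProjBall : IsMatrixConvex (rowProjBall X) where
  directSum := matBlocks_mem_rowProjBall
  sandwich := by
    rintro m n α' _ β' hα' hβ' ⟨p, q, α, v, w, β, hα, hv, hw, hβ, rfl⟩
    exact ⟨p, q, α' * α, v, w, β * β',
      (l2_opNorm_mul _ _).trans (mul_le_one₀ hα' (norm_nonneg _) hα), hv, hw,
      (l2_opNorm_mul _ _).trans (mul_le_one₀ hβ (norm_nonneg _) hβ'),
      matSandwich_matSandwich α' α _ β β'⟩
  absorbing {m} u := by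
    obtain ⟨p, q, α, v, w, β, rfl⟩ := exists_eq_matSandwich_rowTensor u
    have scale_le_one {r : ℝ} (hr : 0 ≤ r) : ‖(((1 + r)⁻¹ : ℝ) : ℂ)‖ * r ≤ 1 := by
      rw [Complex.norm_real, Real.norm_of_nonneg (by positivity)]
      exact inv_mul_le_one_of_le₀ (by linarith) (by positivity)
    have hv : 0 ≤ rowScalarNorm v := norm_nonneg _
    have hw : 0 ≤ matNorm q w := apply_nonneg _ _
    refine ⟨(1 + ‖α‖)⁻¹ * (1 + ‖β‖)⁻¹ * ((1 + rowScalarNorm v)⁻¹ * (1 + matNorm q w)⁻¹),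
      by positivity, p, q, (((1 + ‖α‖)⁻¹ : ℝ) : ℂ) • α,
      (((1 + rowScalarNorm v)⁻¹ : ℝ) : ℂ) • v, (((1 + matNorm q w)⁻¹ : ℝ) : ℂ) • w,
      (((1 + ‖β‖)⁻¹ : ℝ) : ℂ) • β, ?_, ?_, ?_, ?_, ?_⟩
    · exact (norm_smul _ _).trans_le (scale_le_one (norm_nonneg α))
    · exact (rowScalarNorm_smul _ v).trans_le (scale_le_one hv)
    · exact (map_smul_eq_mul _ _ _).trans_le (scale_le_one hw)
    · exact (norm_smul _ _).trans_le (scale_le_one (norm_nonneg β))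
    · have sandwich_smul (r : ℂ) : matSandwich α (r • rowTensor v w) β =
          r • matSandwich α (rowTensor v w) β := (matSandwichLinear α β).map_smul r _
      rw [rowTensor_smul_smul, matSandwich_smul_smul, sandwich_smul, smul_smul]
      push_cast
      rfl

lemma mul_rowProjNorm_le_one {c : ℝ} (hc : 0 < c)
    (h : (c : ℂ) • rowMatrix x y ∈ rowProjBall X n) : c * rowProjNorm x y ≤ 1 := by
  obtain ⟨p, q, α, v, w, β, hα, hv, hw, hβ, h⟩ := h
  have hv₀ : 0 ≤ rowScalarNorm v := norm_nonneg _
  have rep : rowMatrix x y = matSandwich ((c : ℂ)⁻¹ • α) (rowTensor v w) β := by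
    rw [← one_smul ℂ β, matSandwich_smul_smul, ← h, mul_one,
      inv_smul_smul₀ (Complex.ofReal_ne_zero.mpr hc.ne')]
  have le_inv : rowProjNorm x y ≤ c⁻¹ := by
    calc rowProjNorm x y ≤ ‖(c : ℂ)⁻¹ • α‖ * rowScalarNorm v * matNorm q w * ‖β‖ :=
          rowProjNorm_le rep
      _ ≤ (c⁻¹ * 1) * 1 * 1 * 1 := by
          rw [norm_smul, norm_inv, Complex.norm_real, Real.norm_of_nonneg hc.le]
          gcongr
      _ = c⁻¹ := by ring
  rwa [← le_inv_mul_iff₀ hc, mul_one]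

end ProjectiveNorm

section ProjectiveNormDuality

variable {X : Type*} [NormedAddCommGroup X] [NormedSpace ℂ X] [OperatorSpace X] {m n : ℕ}
  {x y : Matrix (Fin n) (Fin n) X}

lemma norm_matEval_rowTensor_le_one {f : Matrix (Fin n) (Fin n) (X × X →ₗ[ℂ] ℂ)}
    (hf : ∀ (m : ℕ) (u : Matrix (Fin m) (Fin m) (X × X)), u ∈ rowProjBall X m → ‖matEval f u‖ ≤ 1)
    {p q : ℕ} {v : Fin 2 → Matrix (Fin p) (Fin p) ℂ} (hv : rowScalarNorm v ≤ 1)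
    {w : Matrix (Fin q) (Fin q) X} (hw : matNorm q w ≤ 1) : ‖matEval f (rowTensor v w)‖ ≤ 1 := by
  let e : Fin (p * q) ≃ Fin p × Fin q := finProdFinEquiv.symm
  have reindexed : ‖matEval f ((rowTensor v w).submatrix e e)‖ ≤ 1 :=
    hf (p * q) _ ⟨p, q, _, v, w, _, l2_one_submatrix_le e.injective Function.injective_id, hv, hw,
      l2_one_submatrix_le Function.injective_id e.injective,
      (matSandwich_one_submatrix e e _).symm⟩
  rwa [← l2_submatrix_equiv _ ((Equiv.refl _).prodCongr e) ((Equiv.refl _).prodCongr e)]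

lemma rowScalarNorm_single_le :
    rowScalarNorm (fun k : Fin 2 => (single k 0 1 : Matrix (Fin 2) (Fin 2) ℂ)) ≤ 1 := by
  let V : Matrix (Fin 2) (Fin 2 ⊕ Fin 2) ℂ := fromCols (single 0 0 1) (single 1 0 1)
  have coisometry : V * Vᴴ = 1 := by
    ext i j
    fin_cases i <;> fin_cases j <;>
      simp [V, conjTranspose_fromCols_eq_fromRows_conjTranspose, fromCols_mul_fromRows]
  rw [rowScalarNorm_eq, ← abs_norm, abs_le_one_iff_mul_self_le_one,
    ← l2_mul_conjTranspose_self, coisometry]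
  exact l2_one_le

lemma norm_fromRows_matEval_le_one {f : Matrix (Fin n) (Fin n) (X × X →ₗ[ℂ] ℂ)}
    (hf : ∀ (m : ℕ) (u : Matrix (Fin m) (Fin m) (X × X)), u ∈ rowProjBall X m → ‖matEval f u‖ ≤ 1)
    {w : Matrix (Fin m) (Fin m) X} (hw : matNorm m w ≤ 1) :
    ‖fromRows (matEval (f.map (· ∘ₗ LinearMap.inl ℂ X X)) w)
      (matEval (f.map (· ∘ₗ LinearMap.inr ℂ X X)) w)‖ ≤ 1 := by
  refine le_trans (le_of_eq_of_le ?_ (l2_submatrix_le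
    (matEval f (rowTensor (fun k : Fin 2 => single k (0 : Fin 2) 1) w))
    (Sum.elim (fun i : Fin n × Fin m => (i.1, 0, i.2)) (fun i : Fin n × Fin m => (i.1, 1, i.2)))
    (fun j : Fin n × Fin m => (j.1, 0, j.2)) ?_ ?_))
    (norm_matEval_rowTensor_le_one hf rowScalarNorm_single_le hw)
  · congr 1
    ext (i | i) j <;> simp [matEval, rowTensor, rowMatrix]
  · rintro (⟨i, k⟩ | ⟨i, k⟩) (⟨j, l⟩ | ⟨j, l⟩) h <;> simp_all
  · rintro ⟨i, k⟩ ⟨j, l⟩ h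
    simp_all

lemma exists_colNorm_le_one_of_polar_rowProjBall {f : Matrix (Fin n) (Fin n) (X × X →ₗ[ℂ] ℂ)}
    (hf : ∀ (m : ℕ) (u : Matrix (Fin m) (Fin m) (X × X)), u ∈ rowProjBall X m → ‖matEval f u‖ ≤ 1) :
    ∃ g h : Matrix (Fin n) (Fin n) (StrongDual ℂ X), colNorm g h ≤ 1 ∧
      ∀ i j a b, f i j (a, b) = g i j a + h i j b := by
  let f₀ := f.map (· ∘ₗ LinearMap.inl ℂ X X)
  let f₁ := f.map (· ∘ₗ LinearMap.inr ℂ X X)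
  obtain ⟨F, hF, hF_norm⟩ := exists_matNorm_le_one_of_norm_matEval_le_one
    (f := matBlocks f₀ 0 f₁ 0) fun m w hw =>
      (norm_matEval_column (fun _ => rfl) f₀ f₁ w).trans_le (norm_fromRows_matEval_le_one hf hw)
  let B := reindex finSumFinEquiv.symm finSumFinEquiv.symm F
  refine ⟨B.toBlocks₁₁, B.toBlocks₂₁, ?_, fun i j a b => ?_⟩
  · have F_eq : F = matBlocks B.toBlocks₁₁ 0 B.toBlocks₂₁ 0 := by
      ext i j v
      obtain ⟨i | i, rfl⟩ := finSumFinEquiv.surjective i <;>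
        obtain ⟨j | j, rfl⟩ := finSumFinEquiv.surjective j <;>
        simp [matBlocks, hF, B, toBlocks₁₁, toBlocks₂₁, -finSumFinEquiv_apply_left,
          -finSumFinEquiv_apply_right]
    rwa [colNorm, ← F_eq]
  · have hg : B.toBlocks₁₁ i j a = f i j (a, 0) := by
      simp [B, toBlocks₁₁, hF, matBlocks, f₀, -finSumFinEquiv_apply_left]
    have hh : B.toBlocks₂₁ i j b = f i j (0, b) := by
      simp [B, toBlocks₂₁, hF, matBlocks, f₁, -finSumFinEquiv_apply_left,
        -finSumFinEquiv_apply_right]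
    rw [hg, hh, ← map_add, Prod.mk_add_mk, add_zero, zero_add]

theorem rowProjNorm_le_of_forall_norm_matPairing_le {C : ℝ}
    (h : ∀ f g : Matrix (Fin n) (Fin n) (StrongDual ℂ X), colNorm f g ≤ 1 →
      ‖matPairing f x + matPairing g y‖ ≤ C) : rowProjNorm x y ≤ C := by
  refine isMatrixConvex_rowProjBall.le_of_forall_norm_matEval_le (x₀ := rowMatrix x y)
    (fun c hc hxy => mul_rowProjNorm_le_one hc hxy) fun f hf => ?_
  obtain ⟨g₀, g₁, hg, hfg⟩ := exists_colNorm_le_one_of_polar_rowProjBall hf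
  have e : matEval f (rowMatrix x y) = matPairing g₀ x + matPairing g₁ y := by
    ext p q
    exact hfg _ _ _ _
  exact e ▸ h g₀ g₁ hg

end ProjectiveNormDuality

section LeftMProjectionAdjoint

variable {X : Type*} [NormedAddCommGroup X] [NormedSpace ℂ X] [OperatorSpace X] {m n : ℕ}

lemma IsCompleteLeftMProjection.colNorm_map_le {P : X →ₗ[ℂ] X} (hP : IsCompleteLeftMProjection P)
    (x y : Matrix (Fin n) (Fin n) X) : colNorm (x.map P) (y - y.map P) ≤ colNorm x y := by
  let M := matBlocks x 0 y 0
  let rows : Fin (n + n) → Fin ((n + n) + (n + n)) := finSumFinEquiv ∘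
    Sum.map (finSumFinEquiv ∘ Sum.inl) (finSumFinEquiv ∘ Sum.inr) ∘ finSumFinEquiv.symm
  have rows_injective : rows.Injective := finSumFinEquiv.injective.comp
    (((finSumFinEquiv.injective.comp Sum.inl_injective).sumMap
      (finSumFinEquiv.injective.comp Sum.inr_injective)).comp finSumFinEquiv.symm.injective)
  have e : matBlocks (x.map P) 0 (y - y.map P) 0 =
      (matBlocks (M.map P) 0 (M - M.map P) 0).submatrix rows (finSumFinEquiv ∘ Sum.inl) := by
    ext i j
    obtain ⟨i | i, rfl⟩ := finSumFinEquiv.surjective i <;>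
      obtain ⟨j | j, rfl⟩ := finSumFinEquiv.surjective j <;>
      simp [matBlocks, M, rows, -finSumFinEquiv_apply_left, -finSumFinEquiv_apply_right]
  calc colNorm (x.map P) (y - y.map P) ≤ colNorm (M.map P) (M - M.map P) := by
        rw [colNorm, e]
        exact matNorm_submatrix_le _ rows_injective
          (finSumFinEquiv.injective.comp Sum.inl_injective)
    _ = colNorm x y := (hP.2 _ M).symm

omit [OperatorSpace X] in
lemma matPairing_dualMap_add (T : X →L[ℂ] X) (f g : Matrix (Fin m) (Fin m) (StrongDual ℂ X))
    (x : Matrix (Fin n) (Fin n) X) :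
    matPairing (f.map (dualMap T).toLinearMap + (g - g.map (dualMap T).toLinearMap)) x =
      matPairing f (x.map T.toLinearMap) + matPairing g (x - x.map T.toLinearMap) := by
  ext i j
  simp [matPairing, dualMap]

lemma isCompleteRightLProjection_of_dualMap {T : X →L[ℂ] X}
    (hT : IsCompleteLeftMProjection (dualMap T).toLinearMap) :
    IsCompleteRightLProjection T.toLinearMap := by
  set D := (dualMap T).toLinearMap
  have hD (f : StrongDual ℂ X) : D (D f) = D f := LinearMap.congr_fun hT.1 f
  refine ⟨dualMap_comp_self_iff.mp hT.1, fun n x => le_antisymm ?_ ?_⟩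
  · refine matNorm_le_of_forall_norm_matPairing_le fun f hf => ?_
    have split : f = (f.map D).map D + ((f - f.map D) - (f - f.map D).map D) := by
      ext1 i j
      simp [hD]
    calc ‖matPairing f x‖
        = ‖matPairing (f.map D) (x.map T.toLinearMap) +
            matPairing (f - f.map D) (x - x.map T.toLinearMap)‖ := by
          rw [← matPairing_dualMap_add, ← split]
      _ ≤ colNorm (f.map D) (f - f.map D) * rowProjNorm (x.map T.toLinearMap)
            (x - x.map T.toLinearMap) := norm_matPairing_add_le _ _ _ _
      _ ≤ rowProjNorm (x.map T.toLinearMap) (x - x.map T.toLinearMap) :=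
          mul_le_of_le_one_left (rowProjNorm_nonneg _ _) ((hT.2 n f).symm.trans_le hf)
  · refine rowProjNorm_le_of_forall_norm_matPairing_le fun f g hfg => ?_
    rw [← matPairing_dualMap_add]
    set F := f.map D + (g - g.map D)
    have hF : F.map D = f.map D := by
      ext1 i j
      simp [F, hD]
    have hF_norm : matNorm n F ≤ 1 := by
      rw [hT.2, hF, show F - f.map D = g - g.map D from add_sub_cancel_left _ _]
      exact (hT.colNorm_map_le f g).trans hfg
    exact (norm_matPairing_le F x).trans (mul_le_of_le_one_left (apply_nonneg _ _) hF_norm)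

lemma isCompleteLeftLSummand_ker {T : X →L[ℂ] X}
    (hT : IsCompleteLeftMProjection (dualMap T).toLinearMap) :
    IsCompleteLeftLSummand T.toLinearMap.ker := by
  have dualMap_id_sub : (dualMap (ContinuousLinearMap.id ℂ X - T)).toLinearMap =
      LinearMap.id - (dualMap T).toLinearMap := by
    ext f x
    exact map_sub f x (T x)
  refine ⟨_, isCompleteRightLProjection_of_dualMap (dualMap_id_sub ▸ hT.id_sub), ?_⟩
  exact (LinearMap.IsIdempotentElem.ker_eq_range (dualMap_comp_self_iff.mp hT.1)).symm

end LeftMProjectionAdjoint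

namespace IsCompleteRightLProjection

variable {X : Type*} [NormedAddCommGroup X] [NormedSpace ℂ X] [OperatorSpace X] {P Q : X →ₗ[ℂ] X}

lemma norm_add_sq_le (hP : IsCompleteRightLProjection P) (f g : StrongDual ℂ X) (x : X) :
    ‖f (P x) + g (x - P x)‖ ^ 2 ≤ (‖f‖ ^ 2 + ‖g‖ ^ 2) * ‖x‖ ^ 2 := by
  let F : Matrix (Fin 1) (Fin 1) (StrongDual ℂ X) := of fun _ _ => f
  let G : Matrix (Fin 1) (Fin 1) (StrongDual ℂ X) := of fun _ _ => g
  let M : Matrix (Fin 1) (Fin 1) X := of fun _ _ => x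
  have le_colNorm_mul : ‖f (P x) + g (x - P x)‖ ≤ colNorm F G * ‖x‖ := by
    have h := (l2_entry_le _ (0, 0) (0, 0)).trans
      (norm_matPairing_add_le F G (M.map P) (M - M.map P))
    rwa [← hP.2, matNorm_one] at h
  have colNorm_le := colNorm_sq_le F G
  rw [matNorm_one, matNorm_one] at colNorm_le
  calc ‖f (P x) + g (x - P x)‖ ^ 2 ≤ (colNorm F G * ‖x‖) ^ 2 := by gcongr
    _ = colNorm F G ^ 2 * ‖x‖ ^ 2 := mul_pow ..
    _ ≤ (‖f‖ ^ 2 + ‖g‖ ^ 2) * ‖x‖ ^ 2 := by gcongr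

lemma isContractiveProjection (hP : IsCompleteRightLProjection P) : IsContractiveProjection P := by
  refine ⟨hP.1, fun x => NormedSpace.norm_le_dual_bound ℂ _ (norm_nonneg x) fun f => ?_⟩
  rw [mul_comm, ← sq_le_sq₀ (norm_nonneg _) (by positivity), mul_pow, mul_comm]
  simpa [mul_comm] using hP.norm_add_sq_le f 0 x

lemma isPythagorean_dualMap {T : X →L[ℂ] X} (hT : IsCompleteRightLProjection T.toLinearMap) :
    IsPythagorean (dualMap T).toLinearMap := by
  intro u v
  set f := dualMap T u
  set g := v - dualMap T v
  have hTT (x : X) : T (T x) = T x := LinearMap.congr_fun hT.1 x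
  have split (x : X) : (f + g) x = f (T x) + g (x - T x) := by
    simp [f, g, dualMap, hTT]
  have h : ‖f + g‖ ≤ √(‖f‖ ^ 2 + ‖g‖ ^ 2) := by
    refine ContinuousLinearMap.opNorm_le_bound _ (Real.sqrt_nonneg _) fun x => ?_
    rw [split, ← sq_le_sq₀ (norm_nonneg _) (by positivity), mul_pow, Real.sq_sqrt (by positivity)]
    exact hT.norm_add_sq_le f g x
  exact (Real.le_sqrt (norm_nonneg _) (by positivity)).mp h

theorem eq_of_ker_eq (hP : IsCompleteRightLProjection P) (hQ : IsContractiveProjection Q)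
    (h : Q.ker = P.ker) : Q = P := by
  let S := hP.isContractiveProjection.toCLM
  let T := hQ.toCLM
  have hS : IsCompleteRightLProjection S.toLinearMap := hP
  have hT : IsContractiveProjection T.toLinearMap := hQ
  have dualMap_eq : (dualMap S).toLinearMap = (dualMap T).toLinearMap := by
    refine hS.isPythagorean_dualMap.eq_of_range_eq (dualMap_comp_self_iff.mpr hS.1) hT.dualMap ?_
    rw [range_dualMap hS.1, range_dualMap hT.1]
    exact congrArg _ h
  have hST : S = T := dualMap_injective (ContinuousLinearMap.coe_injective dualMap_eq)
  exact congrArg ContinuousLinearMap.toLinearMap hST.symm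

end IsCompleteRightLProjection

theorem IsCompleteRightMIdeal.exists_isCompleteLeftLSummand {X : Type*} [NormedAddCommGroup X]
    [NormedSpace ℂ X] [OperatorSpace X] {J : Submodule ℂ X} (hJ : IsCompleteRightMIdeal J)
    {Y : Type*} [NormedAddCommGroup Y] [NormedSpace ℂ Y] [CompleteSpace Y] [OperatorSpace Y]
    (e : X ≃ₗ[ℂ] StrongDual ℂ Y) (he : IsCompleteIsometry e.toLinearMap)
    (hJ_closed : IsClosed ((fun x => StrongDual.toWeakDual (e x)) '' (J : Set X))) :
    IsCompleteRightMSummand J ∧ ∃ K : Submodule ℂ Y, IsCompleteLeftLSummand K ∧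
      J.map e.toLinearMap = StrongDual.polarSubmodule ℂ K := by
  obtain ⟨Q, R, hQ, hQJ, hQR⟩ := hJ.exists_preadjoint ⟨e, he.norm_apply⟩ hJ_closed
  have intertwines (x : X) : e (Q x) = dualMap R (e x) := ContinuousLinearMap.ext (hQR x)
  have he_symm : IsCompleteIsometry e.symm.toLinearMap := fun n f => by
    rw [← he n]
    congr 1
    ext1 i j
    exact e.apply_symm_apply _
  have hR : IsCompleteLeftMProjection (dualMap R).toLinearMap :=
    hQ.of_isCompleteIsometry he_symm fun f => by
      rw [← e.injective.eq_iff]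
      exact (intertwines _).trans (by simp)
  refine ⟨⟨Q, hQ, hQJ⟩, _, isCompleteLeftLSummand_ker hR, ?_⟩
  have comp_eq : e.toLinearMap ∘ₗ Q = (dualMap R).toLinearMap ∘ₗ e.toLinearMap :=
    LinearMap.ext intertwines
  rw [← range_dualMap (dualMap_comp_self_iff.mp hR.1), ← hQJ, ← LinearMap.range_comp, comp_eq,
    LinearMap.range_comp_of_range_eq_top _ e.range]

end OperatorSpace

end

theorem theorem3p10 {X : Type*} [NormedAddCommGroup X] [NormedSpace ℂ X] [OperatorSpace X] :
    -- (a)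
    (∀ P Q : X →ₗ[ℂ] X, OperatorSpace.IsCompleteLeftMProjection P →
      OperatorSpace.IsContractiveProjection Q →
      LinearMap.range Q = LinearMap.range P → P = Q) ∧
    -- (b)
    (∀ P Q : X →ₗ[ℂ] X, OperatorSpace.IsCompleteRightLProjection P →
      OperatorSpace.IsContractiveProjection Q →
      LinearMap.ker Q = LinearMap.ker P → Q = P) ∧
    -- (c)
    (∀ J : Submodule ℂ X, OperatorSpace.IsCompleteRightMIdeal J →
      (∃ Q : X →ₗ[ℂ] X, OperatorSpace.IsContractiveProjection Q ∧ LinearMap.range Q = J) →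
      OperatorSpace.IsCompleteRightMSummand J ∧
      ∃! Q : X →ₗ[ℂ] X, OperatorSpace.IsContractiveProjection Q ∧ LinearMap.range Q = J) ∧
    -- (d)
    (∀ J : Submodule ℂ X, OperatorSpace.IsCompleteRightMIdeal J →
      ∀ (Z : Type*) [NormedAddCommGroup Z] [NormedSpace ℂ Z] [CompleteSpace Z],
      Nonempty (J ≃ₗᵢ[ℂ] StrongDual ℂ Z) → OperatorSpace.IsCompleteRightMSummand J) ∧
    -- (e)
    (∀ (Y : Type*) [NormedAddCommGroup Y] [NormedSpace ℂ Y] [CompleteSpace Y] [OperatorSpace Y]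
      (e : X ≃ₗ[ℂ] StrongDual ℂ Y), OperatorSpace.IsCompleteIsometry e.toLinearMap →
      ∀ J : Submodule ℂ X, OperatorSpace.IsCompleteRightMIdeal J →
      IsClosed ((fun x => StrongDual.toWeakDual (e x)) '' (J : Set X)) →
      OperatorSpace.IsCompleteRightMSummand J ∧
      ∃ K : Submodule ℂ Y, OperatorSpace.IsCompleteLeftLSummand K ∧
        J.map e.toLinearMap = StrongDual.polarSubmodule ℂ K) := by
  refine ⟨fun P Q hP hQ h => hP.eq_of_range_eq hQ h, fun P Q hP hQ h => hP.eq_of_ker_eq hQ h,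
    fun J hJ ⟨Q, hQ, hQJ⟩ => ?_,
    fun J hJ Z _ _ _ ⟨e⟩ => hJ.isCompleteRightMSummand_of_linearIsometryEquiv e,
    fun Y _ _ _ _ e he J hJ hJ_closed => hJ.exists_isCompleteLeftLSummand e he hJ_closed⟩
  have hQM := hJ.isCompleteLeftMProjection hQ hQJ
  exact ⟨⟨Q, hQM, hQJ⟩, Q, ⟨hQ, hQJ⟩,
    fun Q' hQ' => (hQM.eq_of_range_eq hQ'.1 (hQ'.2.trans hQJ.symm)).symm⟩
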